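/- **Notation.** Work in $\mathbb R^d$ with its Euclidean norm and write $B(o,\rho)=\{x:\|x\|\le\rho\}$. For $r,s\in\mathbb N_0$ and $x,u\in\mathbb R^d$ let $x^ru^s$ be the symmetric tensor product of $r$ copies of $x$ and $s$ copies of $u$ (vectors being identified with linear functionals through the scalar product), i.e. the symmetric $(r+s)$-linear form $(v_1,\dots,v_{r+s})\mapsto \frac1{(r+s)!}\sum_{\sigma}\prod_{i\le r}\langle x,v_{\sigma(i)}\rangle\prod_{i>r}\langle u,v_{\sigma(i)}\rangle$, the sum being over all permutations $\sigma$ of $\{1,\dots,r+s\}$. For a tensor $T$ let $|T|=\sup\{|T(v_1,\dots,v_{r+s})|:\|v_i\|\le1\}$. For a nonempty compact set $K\subset\mathbb R^d$ let $p_K$ be the (Lebesgue-almost everywhere uniquely defined) metric projection onto $K$, let $K^R$ be the set of points at distance at most $R$ from $K$, and define the Voronoi tensor $$\mathcal V_R^{r,s}(K)=\int_{K^R}p_K(x)^r\,(x-p_K(x))^s\,dx .$$ For a finite nonempty set $K_0\subset\mathbb R^d$ and $a>0$, let $U_a$ be a random vector that is uniformly distributed on $[0,a]^d$ and put $$\widehat{\mathcal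 V}_R^{r,s}(K_0,a)=a^d\sum_{x\in a\mathbb Z^d+U_a}\mathbf 1\{\|x-p_{K_0}(x)\|<R\}\,p_{K_0}(x)^r\,(x-p_{K_0}(x))^s .$$ For a finite set $K_0$ with at least two points let $N(K_0)=\min\{\|x_1-x_2\|:x_1,x_2\in K_0,\ x_1\ne x_2\}$. Let $d_H$ be the Hausdorff metric. **Theorem.** Let $r,s\in\mathbb N_0$ and $R>0$. (1) For every $\rho>0$ there is a constant $C>0$, depending only on $d,R,\rho,r,s$, such that for every nonempty compact set $K\subseteq B(o,\rho)$, every finite set $K_0\subseteq B(o,\rho)$ with at least two points and every $a>0$, almost surely $$\bigl|\widehat{\mathcal V}_R^{r,s}(K_0,a)-\mathcal V_R^{r,s}(K)\bigr|\le C\left(d_H(K,K_0)^{1/2}+\max\left\{\frac a{N(K_0)},\left(\frac a{N(K_0)}\right)^d\right\}\right),$$ and if $r=s=0$, then this also holds with $d_H(K,K_0)^{1/2}$ replaced by $d_H(K,K_0)$. (2) In particular, let $K\subset\mathbb R^d$ be nonempty and compact, let $(K_0(i))_{i\in\mathbb N}$ be a sequence of finite subsets of $\mathbb R^d$ with at least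 two points each, and let $(a_i)_{i\in\mathbb N}$ be a sequence of positive numbers such that $K_0(i)\to K$ in the Hausdorff metric and $N(K_0(i))^{-1}a_i\to0$ as $i\to\infty$. Then almost surely $\widehat{\mathcal V}_R^{r,s}(K_0(i),a_i)\to\mathcal V_R^{r,s}(K)$ as $i\to\infty$, for any uniform random vectors $U_{a_i}$ on $[0,a_i]^d$ that are defined on a common probability space. -/

import Mathlib

open MeasureTheory Filter Topology

/-- The Euclidean space `ℝᵈ`. -/
abbrev Euc (d : ℕ) : Type := EuclideanSpace ℝ (Fin d)

/-- The `k`-tensors on `ℝᵈ`: `k`-linear maps `(ℝᵈ)ᵏ → ℝ` (automatically continuous). The norm that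
Mathlib puts on this space is `|T| = sup {|T(x₁,…,x_k)| : ‖x_i‖ ≤ 1}`; the symmetric tensors form a
linear subspace, which carries the restricted norm. -/
abbrev Tensor (d k : ℕ) : Type := ContinuousMultilinearMap ℝ (fun _ : Fin k => Euc d) ℝ

/-- The symmetric tensor product `a₁ ⊙ ⋯ ⊙ a_k` of vectors of `ℝᵈ`, each vector `a` being identified
with the functional `⟪a, ·⟫`:
`(a₁ ⊙ ⋯ ⊙ a_k)(x₁,…,x_k) = (1/k!) ∑_σ ∏_i ⟪a_i, x_{σ(i)}⟫`, see `symVecProd_apply`. -/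
noncomputable def symVecProd {d k : ℕ} (a : Fin k → Euc d) : Tensor d k :=
  ((k.factorial : ℝ)⁻¹) • ∑ σ : Equiv.Perm (Fin k),
    ((ContinuousMultilinearMap.mkPiAlgebra ℝ (Fin k) ℝ).compContinuousLinearMap
      (fun i => innerSL ℝ (a i))).domDomCongr σ

theorem symVecProd_apply {d k : ℕ} (a x : Fin k → Euc d) :
    symVecProd a x =
      ((k.factorial : ℝ)⁻¹) * ∑ σ : Equiv.Perm (Fin k), ∏ i, inner ℝ (a i) (x (σ i)) := by
  simp [symVecProd]

/-- `symVecProd` does take values in the symmetric tensors. -/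
theorem symVecProd_symm {d k : ℕ} (a x : Fin k → Euc d) (τ : Equiv.Perm (Fin k)) :
    symVecProd a (fun i => x (τ i)) = symVecProd a x := by
  rw [symVecProd_apply, symVecProd_apply]
  congr 1
  exact Fintype.sum_equiv (Equiv.mulLeft τ) _ _ (fun σ => rfl)

/-- The symmetric tensor `xʳ uˢ` of rank `r + s`: the symmetric tensor product of `r` copies of `x`
and `s` copies of `u`. -/
noncomputable def symPowMul {d : ℕ} (r s : ℕ) (x u : Euc d) : Tensor d (r + s) :=
  symVecProd (Fin.append (fun _ : Fin r => x) (fun _ : Fin s => u))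

/-- The metric projection `p_A` onto a nonempty closed set `A ⊆ ℝᵈ`. It is the nearest point of `A`
wherever that is unique, that is, Lebesgue almost everywhere; at the remaining points some nearest
point is chosen. -/
noncomputable def metricProj {d : ℕ} (A : Set (Euc d)) (z : Euc d) : Euc d :=
  Classical.epsilon fun y => y ∈ A ∧ dist z y = Metric.infDist z A

theorem metricProj_spec {d : ℕ} {A : Set (Euc d)} (hA : IsClosed A) (hne : A.Nonempty)
    (z : Euc d) : metricProj A z ∈ A ∧ dist z (metricProj A z) = Metric.infDist z A := by
  obtain ⟨y, hy, h⟩ := hA.exists_infDist_eq_dist hne z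
  exact Classical.epsilon_spec
    (p := fun y => y ∈ A ∧ dist z y = Metric.infDist z A) ⟨y, hy, h.symm⟩

/-- The Voronoi tensor `𝒱_R^{r,s}(K) = ∫_{K^R} p_K(x)ʳ (x - p_K(x))ˢ dx`, where `K^R` is the closed
`R`-neighbourhood of `K`. -/
noncomputable def voronoiTensor {d : ℕ} (r s : ℕ) (R : ℝ) (K : Set (Euc d)) : Tensor d (r + s) :=
  ∫ x in Metric.cthickening R K, symPowMul r s (metricProj K x) (x - metricProj K x)

/-- The cube `[0,a]ᵈ`. -/
def cube (d : ℕ) (a : ℝ) : Set (Euc d) := {x | ∀ i, x i ∈ Set.Icc 0 a}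

/-- The point `a z + u` of the grid `a ℤᵈ + u`. -/
noncomputable def gridPoint {d : ℕ} (a : ℝ) (u : Euc d) (z : Fin d → ℤ) : Euc d :=
  WithLp.toLp 2 (fun i => a * (z i : ℝ)) + u

open Classical in
/-- The estimator
`𝒱̂_R^{r,s}(K₀,a) = aᵈ ∑_{x ∈ η} 1{‖x - p_{K₀}(x)‖ < R} p_{K₀}(x)ʳ (x - p_{K₀}(x))ˢ`
for the grid `η = a ℤᵈ + u`, as a function of the shift `u`. For `a > 0` and `K₀` finite and
nonempty only finitely many summands are nonzero. -/
noncomputable def voronoiEstimator {d : ℕ} (r s : ℕ) (R : ℝ) (K₀ : Set (Euc d)) (a : ℝ)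
    (u : Euc d) : Tensor d (r + s) :=
  a ^ d • ∑' z : Fin d → ℤ,
    if ‖gridPoint a u z - metricProj K₀ (gridPoint a u z)‖ < R then
      symPowMul r s (metricProj K₀ (gridPoint a u z))
        (gridPoint a u z - metricProj K₀ (gridPoint a u z))
    else 0

/-- `U` is a random vector on the probability space `(Ω, P)` with uniform distribution on the cube
`[0,a]ᵈ`. -/
def IsUniformOnCube {d : ℕ} {Ω : Type*} [MeasurableSpace Ω] (P : Measure Ω) (a : ℝ)
    (U : Ω → Euc d) : Prop :=
  AEMeasurable U P ∧ pdf.IsUniform U (cube d a) P volume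

/-! The bound is deterministic: it holds for every shift of the grid, so the almost sure statements
follow. The error splits as (estimator of K₀ minus tensor of K₀) plus (tensor of K₀ minus tensor of
K).

Everything rests on the potential ‖x‖² - dist(x, A)², a supremum of affine functions and hence
convex, with 2 p_A as a subgradient. So p_A is a monotone map, and Rademacher's theorem yields
almost everywhere uniqueness and measurability. Monotonicity also makes contraction towards A
expand-controlled, which bounds the volume of a shell of width ε around the boundary of a parallel
set (`exists_volume_shell_le`).

Changing the set: if A and B have Hausdorff distance δ, their potentials differ by O(δ) on balls.
Difference quotients of step t bound p_A - p_B by the oscillation of the two monotone maps over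
distance t, of integral O(t), plus O(δ/t). The choice t = √δ gives exponent 1/2
(`exists_integral_norm_metricProj_sub_le`). Points in only one of the two parallel sets lie in a
shell of width O(δ). For r = s = 0 the integrand is constant and only the shell contributes.

Discretizing: the estimator is the integral of a step function that evaluates the integrand at the
corner of the grid cell of each point, at distance at most ε = a√d. Where the projection is the same
at both points, the Lipschitz bound applies; mismatches of the domain lie in a shell. Where the
projection jumps, the point lies in a dilated Voronoi cell but outside the cell itself. Cells are
convex and contain balls of radius m comparable to N(K₀), so the dilation factor is 1 + ε/m and the
excess volume is controlled by a/N(K₀) (`exists_projection_jump_set`). -/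

/-- The symmetric tensor product of vectors as a continuous multilinear map. -/
noncomputable def symVecProdMultilinear (d k : ℕ) :
    ContinuousMultilinearMap ℝ (fun _ : Fin k => Euc d) (Tensor d k) :=
  ((k.factorial : ℝ)⁻¹) • ∑ σ : Equiv.Perm (Fin k),
    (((ContinuousMultilinearMap.domDomCongrₗᵢ ℝ (Euc d) ℝ σ).toContinuousLinearEquiv :
        Tensor d k →L[ℝ] Tensor d k).compContinuousMultilinearMap
      (ContinuousMultilinearMap.compContinuousLinearMapLRight (E := fun _ : Fin k => Euc d)
        (ContinuousMultilinearMap.mkPiAlgebra ℝ (Fin k) ℝ))).compContinuousLinearMap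
      (fun _ => (innerSL ℝ : Euc d →L[ℝ] Euc d →L[ℝ] ℝ))

theorem symVecProdMultilinear_apply {d k : ℕ} (a : Fin k → Euc d) :
    symVecProdMultilinear d k a = symVecProd a := by
  ext x
  simp only [symVecProdMultilinear, symVecProd, smul_apply,
    sum_apply]
  rfl

theorem norm_append_const_le {d r s : ℕ} {x u : Euc d} {B : ℝ} (hB : 0 ≤ B)
    (hx : ‖x‖ ≤ B) (hu : ‖u‖ ≤ B) :
    ‖(Fin.append (fun _ : Fin r => x) (fun _ : Fin s => u) : Fin (r + s) → Euc d)‖ ≤ B := by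
  refine (pi_norm_le_iff_of_nonneg hB).2 fun i => ?_
  refine Fin.addCases (fun j => ?_) (fun j => ?_) i
  · simpa using hx
  · simpa using hu

theorem norm_append_const_sub_le {d r s : ℕ} (x u y v : Euc d) :
    ‖(Fin.append (fun _ : Fin r => x) (fun _ : Fin s => u) : Fin (r + s) → Euc d) -
      Fin.append (fun _ : Fin r => y) (fun _ : Fin s => v)‖ ≤ ‖x - y‖ + ‖u - v‖ := by
  refine (pi_norm_le_iff_of_nonneg (by positivity)).2 fun i => ?_
  refine Fin.addCases (fun j => ?_) (fun j => ?_) i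
  · simp
  · simp

/-- On bounded sets, `symPowMul r s` is bounded and Lipschitz; for `r = s = 0` it is constant. -/
theorem exists_symPowMul_bounds (d r s : ℕ) {B : ℝ} (hB : 0 ≤ B) :
    ∃ L M : ℝ, 0 ≤ L ∧ 0 ≤ M ∧ (r = 0 → s = 0 → L = 0) ∧
      ∀ x u : Euc d, ‖x‖ ≤ B → ‖u‖ ≤ B → ‖symPowMul r s x u‖ ≤ M ∧
        ∀ y v : Euc d, ‖y‖ ≤ B → ‖v‖ ≤ B →
          ‖symPowMul r s x u - symPowMul r s y v‖ ≤ L * (‖x - y‖ + ‖u - v‖) := by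
  set Φ := symVecProdMultilinear d (r + s) with hΦ
  -- These are the operator norm bounds of a multilinear map in r + s arguments. The factor r + s
  -- makes the Lipschitz constant vanish for r = s = 0, which later removes the square root term.
  refine ⟨‖Φ‖ * (r + s : ℕ) * B ^ (r + s - 1), ‖Φ‖ * B ^ (r + s), by positivity, by positivity,
    fun hr hs => by simp [hr, hs], fun x u hx hu => ⟨?_, fun y v hy hv => ?_⟩⟩
  · have h := Φ.le_opNorm (Fin.append (fun _ : Fin r => x) (fun _ : Fin s => u))
    rw [hΦ, symVecProdMultilinear_apply] at h
    refine h.trans (mul_le_mul_of_nonneg_left ?_ (norm_nonneg _))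
    refine (Finset.prod_le_prod (fun i _ => norm_nonneg _)
      (fun i _ => (norm_le_pi_norm _ i).trans (norm_append_const_le hB hx hu))).trans ?_
    simp
  · have h := Φ.norm_image_sub_le (Fin.append (fun _ : Fin r => x) (fun _ : Fin s => u))
      (Fin.append (fun _ : Fin r => y) (fun _ : Fin s => v))
    rw [hΦ, symVecProdMultilinear_apply, symVecProdMultilinear_apply, Fintype.card_fin] at h
    refine h.trans ?_
    gcongr
    · exact max_le (norm_append_const_le hB hx hu) (norm_append_const_le hB hy hv)
    · exact norm_append_const_sub_le x u y v

theorem continuous_symPowMul (d r s : ℕ) :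
    Continuous fun q : Euc d × Euc d => symPowMul r s q.1 q.2 := by
  have h : (fun q : Euc d × Euc d => symPowMul r s q.1 q.2) = fun q =>
      symVecProdMultilinear d (r + s)
        (Fin.append (fun _ : Fin r => q.1) (fun _ : Fin s => q.2)) := by
    ext1 q
    rw [symVecProdMultilinear_apply, symPowMul]
  rw [h]
  refine (symVecProdMultilinear d (r + s)).cont.comp (continuous_pi fun i => ?_)
  refine Fin.addCases (fun j => ?_) (fun j => ?_) i
  · simpa using continuous_fst
  · simpa using continuous_snd

/-! ### Metric projection as half a subgradient of a convex function -/

section Projection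

variable {d : ℕ} {A : Set (Euc d)}

theorem metricProj_mem (hA : IsClosed A) (hne : A.Nonempty) (x : Euc d) : metricProj A x ∈ A :=
  (metricProj_spec hA hne x).1

theorem norm_sub_metricProj (hA : IsClosed A) (hne : A.Nonempty) (x : Euc d) :
    ‖x - metricProj A x‖ = Metric.infDist x A := by
  rw [← dist_eq_norm, (metricProj_spec hA hne x).2]

/-- The function `‖x‖² - dist(x, A)²`, which is convex with subgradient `2 p_A`. -/
noncomputable def projPotential (A : Set (Euc d)) (x : Euc d) : ℝ :=
  ‖x‖ ^ 2 - Metric.infDist x A ^ 2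

/-- Expanding ‖x - y‖² exhibits the potential as an upper envelope of affine functions indexed by y
∈ A; a nearest point gives equality. -/
theorem le_projPotential {y : Euc d} (hy : y ∈ A) (x : Euc d) :
    2 * inner ℝ x y - ‖y‖ ^ 2 ≤ projPotential A x := by
  have h := Metric.infDist_le_dist_of_mem (x := x) hy
  rw [dist_eq_norm] at h
  have h2 := pow_le_pow_left₀ Metric.infDist_nonneg h 2
  rw [norm_sub_sq_real] at h2
  unfold projPotential
  linarith

theorem projPotential_eq_of_dist_eq {x y : Euc d} (h : dist x y = Metric.infDist x A) :
    projPotential A x = 2 * inner ℝ x y - ‖y‖ ^ 2 := by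
  rw [projPotential, ← h, dist_eq_norm, norm_sub_sq_real]
  ring

theorem projPotential_subgradient (hA : IsClosed A) (hne : A.Nonempty) (x z : Euc d) :
    projPotential A x + 2 * inner ℝ (z - x) (metricProj A x) ≤ projPotential A z := by
  obtain ⟨h1, h2⟩ := metricProj_spec hA hne x
  have := le_projPotential h1 z
  rw [projPotential_eq_of_dist_eq h2, inner_sub_left]
  linarith

/-- Sum of the subgradient inequalities at x and at z, as for any convex function. -/
theorem metricProj_monotone (hA : IsClosed A) (hne : A.Nonempty) (x z : Euc d) :
    0 ≤ (inner ℝ (metricProj A x - metricProj A z) (x - z) : ℝ) := by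
  have h1 := projPotential_subgradient hA hne x z
  have h2 := projPotential_subgradient hA hne z x
  rw [inner_sub_left] at h1 h2
  rw [inner_sub_left, inner_sub_right, inner_sub_right]
  rw [real_inner_comm x, real_inner_comm z, real_inner_comm x, real_inner_comm z]
  linarith

/-- At a point of differentiability, the gradient of the potential is twice any nearest point. -/
theorem nearest_eq_of_differentiableAt {x y : Euc d}
    (hd : DifferentiableAt ℝ (projPotential A) x) (hy : y ∈ A)
    (h : dist x y = Metric.infDist x A) :
    y = (1 / 2 : ℝ) • (InnerProductSpace.toDual ℝ (Euc d)).symm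
      (fderiv ℝ (projPotential A) x) := by
  -- The affine minorant given by y touches the potential at x, so the difference is minimal there.
  have hmin : IsLocalMin (fun z => projPotential A z - innerSL ℝ ((2 : ℝ) • y) z) x := by
    refine Filter.Eventually.of_forall fun z => ?_
    have h1 := le_projPotential hy z
    have h2 := projPotential_eq_of_dist_eq h
    simp only [innerSL_apply_apply, real_inner_smul_left, real_inner_comm _ y]
    linarith
  have hf := hmin.fderiv_eq_zero
  rw [fderiv_fun_sub hd (ContinuousLinearMap.differentiableAt _), ContinuousLinearMap.fderiv,
    sub_eq_zero] at hf
  have : (InnerProductSpace.toDual ℝ (Euc d)).symm (innerSL ℝ ((2 : ℝ) • y)) = (2 : ℝ) • y :=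
    (InnerProductSpace.toDual ℝ (Euc d)).symm_apply_apply ((2 : ℝ) • y)
  rw [hf, this, smul_smul]
  norm_num

theorem ae_differentiableAt_projPotential (A : Set (Euc d)) :
    ∀ᵐ x : Euc d, DifferentiableAt ℝ (projPotential A) x := by
  filter_upwards [(Metric.lipschitz_infDist_pt A).ae_differentiableAt] with x hx
  unfold projPotential
  exact (differentiableAt_id.norm_sq ℝ).sub (hx.pow 2)

/-- Almost every point has a unique nearest point in a closed set. -/
theorem ae_nearest_unique (hA : IsClosed A) (hne : A.Nonempty) :
    ∀ᵐ x : Euc d, ∀ y ∈ A, dist x y = Metric.infDist x A → y = metricProj A x := by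
  filter_upwards [ae_differentiableAt_projPotential A] with x hx y hy h
  obtain ⟨h1, h2⟩ := metricProj_spec hA hne x
  rw [nearest_eq_of_differentiableAt hx hy h, ← nearest_eq_of_differentiableAt hx h1 h2]

/-- The projection is defined by arbitrary choice, but it agrees almost everywhere with half the
gradient of the potential, and a derivative is measurable. -/
theorem aemeasurable_metricProj (hA : IsClosed A) (hne : A.Nonempty) :
    AEMeasurable (metricProj A) volume := by
  refine ⟨fun x => (1 / 2 : ℝ) • (InnerProductSpace.toDual ℝ (Euc d)).symm
      (fderiv ℝ (projPotential A) x), ?_, ?_⟩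
  · have h := (InnerProductSpace.toDual ℝ (Euc d)).symm.continuous.measurable.comp
      (measurable_fderiv ℝ (projPotential A))
    exact h.const_smul (1 / 2 : ℝ)
  · filter_upwards [ae_differentiableAt_projPotential A] with x hx
    obtain ⟨h1, h2⟩ := metricProj_spec hA hne x
    exact nearest_eq_of_differentiableAt hx h1 h2

end Projection

/-! ### Volume of shells around a parallel set -/

/-- The d-dimensional Hausdorff measure has this scaling property, and Lebesgue measure is a
multiple of it by uniqueness of Haar measure. -/
theorem AntilipschitzWith.volume_le_image {d : ℕ} {K : NNReal} {T : Euc d → Euc d}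
    (hT : AntilipschitzWith K T) (A : Set (Euc d)) :
    volume A ≤ (K : ENNReal) ^ d * volume (T '' A) := by
  have h := hT.le_hausdorffMeasure_image (d := (Module.finrank ℝ (Euc d) : ℝ)) (by positivity) A
  have hc := Measure.isAddLeftInvariant_eq_smul (volume : Measure (Euc d))
    (Measure.hausdorffMeasure (Module.finrank ℝ (Euc d) : ℝ))
  rw [hc, Measure.smul_apply, Measure.smul_apply]
  have hd : ((K : ENNReal) ^ (Module.finrank ℝ (Euc d) : ℝ)) = (K : ENNReal) ^ d := by
    rw [finrank_euclideanSpace_fin, ENNReal.rpow_natCast]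
  rw [hd] at h
  rw [mul_smul_comm]
  gcongr

section Shell

variable {d : ℕ} {A : Set (Euc d)}

theorem norm_le_infDist_add {ρ : ℝ} (hA : IsClosed A) (hne : A.Nonempty)
    (hρ : A ⊆ Metric.closedBall 0 ρ) (x : Euc d) : ‖x‖ ≤ Metric.infDist x A + ρ := by
  have h1 := norm_sub_metricProj hA hne x
  have h2 := mem_closedBall_zero_iff.1 (hρ (metricProj_mem hA hne x))
  have h3 := norm_le_norm_sub_add x (metricProj A x)
  linarith

/-- Contracting towards the nearest points by the factor `c` maps one shell around `A` to another,
and it decreases the volume at most by the factor `c⁻ᵈ`. -/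
theorem volume_shell_le_scaled (hA : IsClosed A) (hne : A.Nonempty) {c : ℝ} (hc : 1 ≤ c)
    (r t : ℝ) :
    volume {x | r < Metric.infDist x A ∧ Metric.infDist x A ≤ t} ≤
      ENNReal.ofReal (c ^ d) *
        volume {x | r / c < Metric.infDist x A ∧ Metric.infDist x A ≤ t / c} := by
  have hc0 : 0 < c := by linarith
  set T : Euc d → Euc d := fun x => metricProj A x + c⁻¹ • (x - metricProj A x) with hTdef
  have hTd : ∀ x, Metric.infDist (T x) A = Metric.infDist x A / c := by
    intro x
    have hn := norm_sub_metricProj hA hne x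
    have h1 : dist (T x) (metricProj A x) = Metric.infDist x A / c := by
      rw [dist_eq_norm, hTdef]
      simp only [add_sub_cancel_left]
      rw [norm_smul, hn, Real.norm_of_nonneg (by positivity)]
      ring
    have h2 : dist x (T x) = Metric.infDist x A - Metric.infDist x A / c := by
      have : x - T x = (1 - c⁻¹) • (x - metricProj A x) := by
        simp only [hTdef, sub_smul, one_smul]
        abel
      rw [dist_eq_norm, this, norm_smul, hn, Real.norm_of_nonneg
        (by rw [sub_nonneg]; exact inv_le_one_of_one_le₀ hc)]
      ring
    refine le_antisymm (h1 ▸ Metric.infDist_le_dist_of_mem (metricProj_mem hA hne x)) ?_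
    have := Metric.infDist_le_infDist_add_dist (s := A) (x := x) (y := T x)
    linarith
  -- Monotonicity of the projection gives ⟪Tx - Ty, x - y⟫ ≥ c⁻¹ ‖x - y‖²; Cauchy–Schwarz does the
  -- rest.
  have hanti : AntilipschitzWith ⟨c, hc0.le⟩ T := by
    refine AntilipschitzWith.of_le_mul_dist fun x y => ?_
    have hm := metricProj_monotone hA hne x y
    have hT : T x - T y =
        (1 - c⁻¹) • (metricProj A x - metricProj A y) + c⁻¹ • (x - y) := by
      simp only [hTdef, sub_smul, one_smul, smul_sub]
      abel
    have h1 : c⁻¹ * ‖x - y‖ ^ 2 ≤ inner ℝ (T x - T y) (x - y) := by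
      rw [hT, inner_add_left, real_inner_smul_left, real_inner_smul_left,
        real_inner_self_eq_norm_sq]
      have : 0 ≤ 1 - c⁻¹ := sub_nonneg.2 (inv_le_one_of_one_le₀ hc)
      nlinarith
    have h2 := real_inner_le_norm (T x - T y) (x - y)
    rw [dist_eq_norm, dist_eq_norm]
    change ‖x - y‖ ≤ c * ‖T x - T y‖
    rcases eq_or_lt_of_le (norm_nonneg (x - y)) with h0 | h0
    · rw [← h0]; positivity
    · have h3 : c⁻¹ * ‖x - y‖ ≤ ‖T x - T y‖ := by
        refine le_of_mul_le_mul_right ?_ h0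
        nlinarith
      rwa [inv_mul_le_iff₀ hc0] at h3
  refine (hanti.volume_le_image _).trans ?_
  rw [ENNReal.ofReal_pow hc0.le]
  rw [ENNReal.ofReal, Real.toNNReal_of_nonneg hc0.le]
  refine mul_le_mul' le_rfl (measure_mono ?_)
  rintro _ ⟨x, ⟨h1, h2⟩, rfl⟩
  refine ⟨?_, ?_⟩
  · rw [hTd]; gcongr
  · rw [hTd]; gcongr

theorem measurableSet_shell (A : Set (Euc d)) (r t : ℝ) :
    MeasurableSet {x : Euc d | r < Metric.infDist x A ∧ Metric.infDist x A ≤ t} :=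
  (measurableSet_lt measurable_const (Metric.continuous_infDist_pt A).measurable).inter
    (measurableSet_le (Metric.continuous_infDist_pt A).measurable measurable_const)

/-- Contracting the shell by the factors q^j with q = 1 + δ/r and j < n gives n disjoint shells in
one ball. Since q^n ≤ 2, each keeps at least the fraction 2⁻ᵈ of the original volume. -/
theorem nat_mul_volume_shell_le (hA : IsClosed A) (hne : A.Nonempty) {ρ : ℝ}
    (hρ : A ⊆ Metric.closedBall 0 ρ) {r δ : ℝ} (hr : 0 < r) (hδ : 0 < δ) {n : ℕ}
    (hn : (1 + δ / r) ^ n ≤ 2) :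
    (n : ENNReal) * volume {x | r < Metric.infDist x A ∧ Metric.infDist x A ≤ r + δ} ≤
      2 ^ d * volume (Metric.closedBall (0 : Euc d) (ρ + r + δ)) := by
  set q := 1 + δ / r with hq
  have hq1 : 1 < q := by rw [hq]; linarith [div_pos hδ hr]
  have hrq : r + δ = r * q := by rw [hq]; field_simp
  set S : ℕ → Set (Euc d) := fun j =>
    {x | r / q ^ j < Metric.infDist x A ∧ Metric.infDist x A ≤ (r + δ) / q ^ j} with hS
  have hle : ∀ j ∈ Finset.range n,
      volume {x | r < Metric.infDist x A ∧ Metric.infDist x A ≤ r + δ} ≤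
        2 ^ d * volume (S j) := by
    intro j hj
    refine (volume_shell_le_scaled hA hne (one_le_pow₀ hq1.le (n := j)) r (r + δ)).trans ?_
    gcongr
    have h2 : q ^ j ≤ 2 :=
      (pow_le_pow_right₀ hq1.le (Finset.mem_range.1 hj).le).trans hn
    calc ENNReal.ofReal ((q ^ j) ^ d) ≤ ENNReal.ofReal (2 ^ d) := by gcongr
      _ = 2 ^ d := by rw [ENNReal.ofReal_pow (by norm_num)]; norm_num
  have hlt : ∀ i j, i < j → Disjoint (S i) (S j) := by
    intro i j hij
    refine Set.disjoint_left.2 fun x hi hj => ?_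
    have h1 := hi.1
    have h2 := hj.2
    -- Because r + δ = r q, the outer radius of a shell is the inner radius of the preceding one.
    have h3 : (r + δ) / q ^ j ≤ r / q ^ i := by
      rw [div_le_div_iff₀ (by positivity) (by positivity), hrq, mul_assoc, ← pow_succ']
      gcongr
      · exact hq1.le
      · omega
    linarith
  have hdisj : (↑(Finset.range n) : Set ℕ).PairwiseDisjoint S := by
    intro i _ j _ hij
    rcases lt_or_gt_of_ne hij with h | h
    · exact hlt i j h
    · exact (hlt j i h).symm
  calc (n : ENNReal) * volume {x | r < Metric.infDist x A ∧ Metric.infDist x A ≤ r + δ}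
      = ∑ j ∈ Finset.range n,
          volume {x | r < Metric.infDist x A ∧ Metric.infDist x A ≤ r + δ} := by simp
    _ ≤ ∑ j ∈ Finset.range n, 2 ^ d * volume (S j) := Finset.sum_le_sum hle
    _ = 2 ^ d * volume (⋃ j ∈ Finset.range n, S j) := by
        rw [← Finset.mul_sum, measure_biUnion_finset hdisj fun j _ => measurableSet_shell _ _ _]
    _ ≤ _ := by
        gcongr
        refine Set.iUnion₂_subset fun j _ x hx => mem_closedBall_zero_iff.2 ?_
        have h1 := norm_le_infDist_add hA hne hρ x
        have h2 : (r + δ) / q ^ j ≤ r + δ :=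
          div_le_self (by positivity) (one_le_pow₀ hq1.le)
        linarith [hx.2]

theorem volume_real_closedBall_zero (d : ℕ) {r : ℝ} (hr : 0 ≤ r) :
    volume.real (Metric.closedBall (0 : Euc d) r) =
      r ^ d * volume.real (Metric.ball (0 : Euc d) 1) := by
  rw [Measure.addHaar_real_closedBall _ _ hr, finrank_euclideanSpace_fin]

/-- The volume of the `ε`-neighbourhood of the boundary of a parallel set is `O(ε)` for small `ε`
and `O(εᵈ)` for large `ε`. -/
theorem exists_volume_shell_le (d : ℕ) {R ρ : ℝ} (hR : 0 < R) (hρ0 : 0 ≤ ρ) :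
    ∃ C : ℝ, 0 ≤ C ∧ ∀ A : Set (Euc d), IsClosed A → A.Nonempty →
      A ⊆ Metric.closedBall 0 ρ → ∀ ε : ℝ, 0 < ε →
        volume.real {x | R - ε ≤ Metric.infDist x A ∧ Metric.infDist x A ≤ R + ε} ≤
          C * max ε (ε ^ d) := by
  set ω := volume.real (Metric.ball (0 : Euc d) 1) with hω
  have hω0 : 0 ≤ ω := measureReal_nonneg
  refine ⟨2 ^ d * ((ρ + 2 * R) ^ d * ω) * (24 / R) + (12 * (ρ + R) / R + 1) ^ d * ω,
    by positivity, fun A hA hne hρ ε hε => ?_⟩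
  have hm1 : ε ≤ max ε (ε ^ d) := le_max_left _ _
  have hm2 : ε ^ d ≤ max ε (ε ^ d) := le_max_right _ _
  have hm0 : 0 ≤ max ε (ε ^ d) := hε.le.trans hm1
  rcases le_or_gt ε (R / 12) with hsmall | hbig
  -- The half-open shell (R - 2ε, R + ε] contains the closed shell [R - ε, R + ε].
  · set r := R - 2 * ε with hr
    have hrR : 5 * R / 6 ≤ r := by rw [hr]; linarith
    have hr0 : 0 < r := by linarith
    -- With r ≥ 5R/6 this gives n · 3ε/r ≤ 0.3 < log 2, so the powers stay below 2. Rounding down a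
    -- number that is at least 1 loses at most half of it, so n is still of order 1/ε.
    set n := ⌊R / (12 * ε)⌋₊ with hn
    have hx1 : 1 ≤ R / (12 * ε) := by rw [le_div_iff₀ (by positivity)]; linarith
    have hn1 : 1 ≤ n := Nat.le_floor (by simpa using hx1)
    have hnle : (n : ℝ) ≤ R / (12 * ε) := Nat.floor_le (by positivity)
    have hnge : R / (24 * ε) ≤ n := by
      have h1 : R / (12 * ε) < n + 1 := Nat.lt_floor_add_one _
      have h2 : (1 : ℝ) ≤ n := by exact_mod_cast hn1
      have h3 : R / (24 * ε) = R / (12 * ε) / 2 := by field_simp; norm_num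
      rw [h3]; linarith
    have hpow : (1 + 3 * ε / r) ^ n ≤ 2 := by
      have h1 : 1 + 3 * ε / r ≤ Real.exp (3 * ε / r) := by
        rw [add_comm]; exact Real.add_one_le_exp _
      calc (1 + 3 * ε / r) ^ n ≤ Real.exp (3 * ε / r) ^ n := by
            gcongr
        _ = Real.exp (n * (3 * ε / r)) := by rw [← Real.exp_nat_mul]
        _ ≤ Real.exp (Real.log 2) := by
            refine Real.exp_le_exp.2 ?_
            have h4 : n * (3 * ε / r) ≤ R / (12 * ε) * (3 * ε / (5 * R / 6)) := by gcongr
            have h5 : R / (12 * ε) * (3 * ε / (5 * R / 6)) = 0.3 := by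
              field_simp; norm_num
            have := Real.log_two_gt_d9
            linarith
        _ = 2 := Real.exp_log (by norm_num)
    have key := nat_mul_volume_shell_le hA hne hρ hr0 (by positivity : 0 < 3 * ε) hpow
    have hfin : volume {x | r < Metric.infDist x A ∧ Metric.infDist x A ≤ r + 3 * ε} ≠ ⊤ := by
      refine ((measure_mono (t := Metric.closedBall 0 (ρ + r + 3 * ε)) fun x hx =>
        mem_closedBall_zero_iff.2 ?_).trans_lt measure_closedBall_lt_top).ne
      linarith [norm_le_infDist_add hA hne hρ x, hx.2]
    have key2 := ENNReal.toReal_mono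
      (ENNReal.mul_ne_top (by simp) measure_closedBall_lt_top.ne) key
    rw [ENNReal.toReal_mul, ENNReal.toReal_mul] at key2
    simp only [ENNReal.toReal_natCast, ENNReal.toReal_pow, ENNReal.toReal_ofNat] at key2
    change (n : ℝ) * volume.real _ ≤ 2 ^ d * volume.real _ at key2
    rw [volume_real_closedBall_zero d (by positivity)] at key2
    set s := volume.real {x | r < Metric.infDist x A ∧ Metric.infDist x A ≤ r + 3 * ε}
    have hs0 : 0 ≤ s := measureReal_nonneg
    have h1 : volume.real {x | R - ε ≤ Metric.infDist x A ∧ Metric.infDist x A ≤ R + ε} ≤ s := by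
      refine measureReal_mono (fun x hx => ⟨?_, ?_⟩) hfin
      · rw [hr]; linarith [hx.1]
      · rw [hr]; linarith [hx.2]
    have h2 : (ρ + r + 3 * ε) ^ d ≤ (ρ + 2 * R) ^ d :=
      pow_le_pow_left₀ (by positivity) (by rw [hr]; linarith) d
    have h3 : R / (24 * ε) * s ≤ 2 ^ d * ((ρ + 2 * R) ^ d * ω) :=
      (mul_le_mul_of_nonneg_right hnge hs0).trans (key2.trans (by gcongr))
    have h4 : s ≤ 2 ^ d * ((ρ + 2 * R) ^ d * ω) * (24 / R) * ε := by
      have : s = R / (24 * ε) * s * (24 / R) * ε := by field_simp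
      rw [this]
      gcongr
    refine h1.trans (h4.trans ?_)
    rw [add_mul]
    have : 0 ≤ (12 * (ρ + R) / R + 1) ^ d * ω * max ε (ε ^ d) := by positivity
    have := mul_le_mul_of_nonneg_left hm1
      (by positivity : 0 ≤ 2 ^ d * ((ρ + 2 * R) ^ d * ω) * (24 / R))
    linarith
  -- For ε > R/12 the volume of the enclosing ball of radius ρ + R + ε is already O(εᵈ).
  · have h1 : volume.real {x | R - ε ≤ Metric.infDist x A ∧ Metric.infDist x A ≤ R + ε} ≤
        (ρ + R + ε) ^ d * ω := by
      rw [hω, ← volume_real_closedBall_zero d (by positivity)]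
      refine measureReal_mono (fun x hx => mem_closedBall_zero_iff.2 ?_)
        measure_closedBall_lt_top.ne
      linarith [norm_le_infDist_add hA hne hρ x, hx.2]
    have h2 : (ρ + R + ε) ^ d ≤ (12 * (ρ + R) / R + 1) ^ d * ε ^ d := by
      rw [← mul_pow]
      gcongr
      have : (ρ + R) ≤ 12 * (ρ + R) / R * ε := by
        have : ρ + R = 12 * (ρ + R) / R * (R / 12) := by field_simp
        calc ρ + R = 12 * (ρ + R) / R * (R / 12) := this
          _ ≤ _ := by gcongr
      linarith
    calc _ ≤ (ρ + R + ε) ^ d * ω := h1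
      _ ≤ (12 * (ρ + R) / R + 1) ^ d * ε ^ d * ω := by gcongr
      _ = (12 * (ρ + R) / R + 1) ^ d * ω * ε ^ d := by ring
      _ ≤ (12 * (ρ + R) / R + 1) ^ d * ω * max ε (ε ^ d) := by gcongr
      _ ≤ _ := by
        rw [add_mul]
        have : 0 ≤ 2 ^ d * ((ρ + 2 * R) ^ d * ω) * (24 / R) * max ε (ε ^ d) := by positivity
        linarith

end Shell

/-! ### Hölder dependence of the projection on the set, in L¹ -/

section Holder

variable {d : ℕ} {A B : Set (Euc d)}

theorem abs_inner_metricProj_le {ρ : ℝ} (hA : IsClosed A) (hne : A.Nonempty)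
    (hρ : A ⊆ Metric.closedBall 0 ρ) {e : Euc d} (he : ‖e‖ = 1) (x : Euc d) :
    |inner ℝ (metricProj A x) e| ≤ ρ := by
  refine (abs_real_inner_le_norm _ _).trans ?_
  rw [he, mul_one]
  exact mem_closedBall_zero_iff.1 (hρ (metricProj_mem hA hne x))

theorem aestronglyMeasurable_inner_metricProj (hA : IsClosed A) (hne : A.Nonempty) (e : Euc d) :
    AEStronglyMeasurable (fun x => (inner ℝ (metricProj A x) e : ℝ)) volume :=
  ((aemeasurable_metricProj hA hne).inner_const (𝕜 := ℝ) (c := e)).aestronglyMeasurable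

theorem integrableOn_inner_metricProj_add {ρ : ℝ} (hA : IsClosed A) (hne : A.Nonempty)
    (hρ : A ⊆ Metric.closedBall 0 ρ) {e : Euc d} (he : ‖e‖ = 1) (w : Euc d) (x : Euc d) (r : ℝ) :
    IntegrableOn (fun x => (inner ℝ (metricProj A (x + w)) e : ℝ)) (Metric.closedBall x r) := by
  refine Measure.integrableOn_of_bounded measure_closedBall_lt_top.ne
    ((aestronglyMeasurable_inner_metricProj hA hne e).comp_measurePreserving
      (measurePreserving_add_right volume w)) (M := ρ) ?_
  exact Eventually.of_forall fun y => abs_inner_metricProj_le hA hne hρ he _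

theorem setIntegral_closedBall_add (g : Euc d → ℝ) (w : Euc d) (r : ℝ) :
    ∫ x in Metric.closedBall 0 r, g (x + w) = ∫ x in Metric.closedBall w r, g x := by
  have h := (measurePreserving_add_right (volume : Measure (Euc d)) w).setIntegral_preimage_emb
    (measurableEmbedding_addRight w) g (Metric.closedBall w r)
  rw [← h]
  congr 2
  ext x
  simp [dist_eq_norm]

/-- After translation, the two terms are integrals of one bounded function over two balls whose
centres are 2t apart, so they nearly cancel: what remains is controlled by an annulus of width 2t.
-/
theorem integral_inner_metricProj_sub_le {ρ : ℝ} (hA : IsClosed A) (hne : A.Nonempty)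
    (hρ : A ⊆ Metric.closedBall 0 ρ) {e : Euc d} (he : ‖e‖ = 1) {t r : ℝ} (ht : 0 ≤ t)
    (htr : t ≤ r) :
    ∫ x in Metric.closedBall 0 r,
        ((inner ℝ (metricProj A (x + t • e)) e : ℝ) - inner ℝ (metricProj A (x + (-t) • e)) e) ≤
      2 * ρ * (volume.real (Metric.ball (0 : Euc d) 1) * (2 * t * d * (2 * r) ^ (d - 1))) := by
  set q : Euc d → ℝ := fun x => inner ℝ (metricProj A x) e with hq
  have hqb : ∀ x, |q x| ≤ ρ := abs_inner_metricProj_le hA hne hρ he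
  have hint : ∀ x r, IntegrableOn (fun x => q x + ρ) (Metric.closedBall x r) := fun x r => by
    have h := integrableOn_inner_metricProj_add hA hne hρ he 0 x r
    simp only [add_zero] at h
    exact h.add (integrableOn_const measure_closedBall_lt_top.ne)
  -- Adding ρ leaves the difference unchanged and makes the integrand nonnegative, so that one ball
  -- may be enlarged and the other shrunk.
  have hq0 : ∀ x, 0 ≤ q x + ρ := fun x => by linarith [(abs_le.1 (hqb x)).1]
  have h1 : ∫ x in Metric.closedBall 0 r, (q (x + t • e) - q (x + (-t) • e)) =
      (∫ x in Metric.closedBall (t • e) r, (q x + ρ)) -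
        ∫ x in Metric.closedBall ((-t) • e) r, (q x + ρ) := by
    have hi : ∀ w, IntegrableOn (fun x => q (x + w) + ρ) (Metric.closedBall 0 r) := fun w =>
      (integrableOn_inner_metricProj_add hA hne hρ he w 0 r).add
        (integrableOn_const measure_closedBall_lt_top.ne)
    rw [← setIntegral_closedBall_add (fun x => q x + ρ),
      ← setIntegral_closedBall_add (fun x => q x + ρ), ← integral_sub (hi _) (hi _)]
    simp only [add_sub_add_right_eq_sub]
  rw [h1]
  have hte : ‖t • e‖ = t := by rw [norm_smul, he, mul_one, Real.norm_of_nonneg ht]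
  have h2 : ∫ x in Metric.closedBall (t • e) r, (q x + ρ) ≤
      ∫ x in Metric.closedBall 0 (r + t), (q x + ρ) := by
    refine setIntegral_mono_set (hint _ _) (Eventually.of_forall fun x => hq0 x)
      (Metric.closedBall_subset_closedBall' ?_).eventuallyLE
    rw [dist_zero_right, hte]
  have h3 : ∫ x in Metric.closedBall 0 (r - t), (q x + ρ) ≤
      ∫ x in Metric.closedBall ((-t) • e) r, (q x + ρ) := by
    refine setIntegral_mono_set (hint _ _) (Eventually.of_forall fun x => hq0 x)
      (Metric.closedBall_subset_closedBall' ?_).eventuallyLE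
    rw [dist_zero_left, neg_smul, norm_neg, hte]
    linarith
  have hsub : Metric.closedBall (0 : Euc d) (r - t) ⊆ Metric.closedBall 0 (r + t) :=
    Metric.closedBall_subset_closedBall (by linarith)
  have h4 := setIntegral_sdiff (μ := volume) Metric.isClosed_closedBall.measurableSet (hint _ _) hsub
  have h5 := norm_setIntegral_le_of_norm_le_const (μ := volume)
    (s := Metric.closedBall (0 : Euc d) (r + t) \ Metric.closedBall 0 (r - t))
    (f := fun x => q x + ρ) (C := 2 * ρ)
    ((measure_mono Set.sdiff_subset).trans_lt measure_closedBall_lt_top) (fun x _ => by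
      rw [Real.norm_of_nonneg (hq0 x)]; linarith [(abs_le.1 (hqb x)).2])
  have h6 := (le_abs_self _).trans h5
  rw [measureReal_sdiff hsub Metric.isClosed_closedBall.measurableSet
    measure_closedBall_lt_top.ne, volume_real_closedBall_zero d (by linarith),
    volume_real_closedBall_zero d (by linarith)] at h6
  have hρ0 : 0 ≤ ρ := (abs_nonneg _).trans (hqb 0)
  have h7 : (r + t) ^ d - (r - t) ^ d ≤ 2 * t * d * (2 * r) ^ (d - 1) := by
    have h := abs_pow_sub_pow_le (r + t) (r - t) d
    refine (le_abs_self _).trans (h.trans ?_)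
    rw [abs_of_nonneg (by linarith : 0 ≤ r + t - (r - t)), abs_of_nonneg (by linarith : 0 ≤ r + t),
      abs_of_nonneg (by linarith : 0 ≤ r - t), max_eq_left (by linarith)]
    have : (r + t) ^ (d - 1) ≤ (2 * r) ^ (d - 1) :=
      pow_le_pow_left₀ (by linarith) (by linarith) _
    have h' : r + t - (r - t) = 2 * t := by ring
    rw [h']
    gcongr
  set ω := volume.real (Metric.ball (0 : Euc d) 1)
  have hω0 : 0 ≤ ω := measureReal_nonneg
  have h8 : (r + t) ^ d * ω - (r - t) ^ d * ω ≤ ω * (2 * t * d * (2 * r) ^ (d - 1)) := by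
    rw [← sub_mul, mul_comm ω]
    gcongr
  have h9 := mul_le_mul_of_nonneg_left h8 (by positivity : 0 ≤ 2 * ρ)
  linarith

/-- The slope of the potential of A at x is at most its difference quotient over [x, x + te].
Passing to B costs 2η/(2t), and the quotient for B is at most the slope at x + te. Along e, the
slope of B at x is at least that at x - te. -/
theorem inner_metricProj_sub_le (hA : IsClosed A) (hAn : A.Nonempty) (hB : IsClosed B)
    (hBn : B.Nonempty) {η t : ℝ} (ht : 0 < t) (x e : Euc d)
    (hη : ∀ s ∈ ({0, t, -t} : Set ℝ),
      |projPotential A (x + s • e) - projPotential B (x + s • e)| ≤ η) :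
    inner ℝ (metricProj A x) e - inner ℝ (metricProj B x) e ≤
      (inner ℝ (metricProj B (x + t • e)) e - inner ℝ (metricProj B (x + (-t) • e)) e : ℝ)
        + η / t := by
  have a1 := projPotential_subgradient hA hAn x (x + t • e)
  have a2 := projPotential_subgradient hB hBn x (x + (-t) • e)
  have a3 := projPotential_subgradient hB hBn (x + t • e) x
  have a4 := projPotential_subgradient hB hBn (x + (-t) • e) x
  have e0 := abs_le.1 (hη 0 (by simp))
  have e1 := abs_le.1 (hη t (by simp))
  simp only [zero_smul, add_zero] at e0
  simp only [add_sub_cancel_left, sub_add_cancel_left, real_inner_smul_left, inner_neg_left]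
    at a1 a2 a3 a4
  simp only [real_inner_comm _ e] at a1 a2 a3 a4
  rw [← sub_le_iff_le_add', le_div_iff₀ ht]
  nlinarith

/-- Both one-sided bounds are covered by adding the two oscillations, which are nonnegative by
monotonicity. -/
theorem abs_inner_metricProj_sub_le (hA : IsClosed A) (hAn : A.Nonempty) (hB : IsClosed B)
    (hBn : B.Nonempty) {η t : ℝ} (ht : 0 < t) (x e : Euc d)
    (hη : ∀ s ∈ ({0, t, -t} : Set ℝ),
      |projPotential A (x + s • e) - projPotential B (x + s • e)| ≤ η) :
    |inner ℝ (metricProj A x) e - inner ℝ (metricProj B x) e| ≤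
      (inner ℝ (metricProj A (x + t • e)) e - inner ℝ (metricProj A (x + (-t) • e)) e) +
      (inner ℝ (metricProj B (x + t • e)) e - inner ℝ (metricProj B (x + (-t) • e)) e : ℝ)
        + η / t := by
  have h1 := inner_metricProj_sub_le hA hAn hB hBn ht x e hη
  have h2 := inner_metricProj_sub_le hB hBn hA hAn ht x e fun s hs => by
    rw [abs_sub_comm]; exact hη s hs
  have hm : ∀ D : Set (Euc d), IsClosed D → D.Nonempty → (0 : ℝ) ≤
      inner ℝ (metricProj D (x + t • e)) e - inner ℝ (metricProj D (x + (-t) • e)) e := by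
    intro D hD hDn
    have h := metricProj_monotone hD hDn (x + t • e) (x + (-t) • e)
    have h' : x + t • e - (x + (-t) • e) = (2 * t) • e := by
      rw [two_mul, add_smul, neg_smul]; abel
    rw [h', real_inner_smul_right, inner_sub_left] at h
    exact nonneg_of_mul_nonneg_right h (by positivity)
  have hmA := hm A hA hAn
  have hmB := hm B hB hBn
  rw [abs_le]
  constructor <;> linarith

theorem abs_projPotential_sub_le {ρ δ : ℝ} (hAn : A.Nonempty)
    (hAρ : A ⊆ Metric.closedBall 0 ρ)
    (hBn : B.Nonempty) (hBρ : B ⊆ Metric.closedBall 0 ρ)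
    (hδ : ∀ x, |Metric.infDist x A - Metric.infDist x B| ≤ δ) (x : Euc d) :
    |projPotential A x - projPotential B x| ≤ δ * (2 * (‖x‖ + ρ)) := by
  have hle : ∀ D : Set (Euc d), D.Nonempty → D ⊆ Metric.closedBall 0 ρ →
      Metric.infDist x D ≤ ‖x‖ + ρ := by
    rintro D ⟨y, hy⟩ hD
    have h1 := Metric.infDist_le_dist_of_mem (x := x) hy
    have h2 := mem_closedBall_zero_iff.1 (hD hy)
    rw [dist_eq_norm] at h1
    linarith [norm_sub_le x y]
  have h1 := hle A hAn hAρ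
  have h2 := hle B hBn hBρ
  have h : projPotential A x - projPotential B x =
      -((Metric.infDist x A - Metric.infDist x B) * (Metric.infDist x A + Metric.infDist x B)) := by
    unfold projPotential; ring
  have h0 : 0 ≤ Metric.infDist x A + Metric.infDist x B :=
    add_nonneg Metric.infDist_nonneg Metric.infDist_nonneg
  rw [h, abs_neg, abs_mul, abs_of_nonneg h0]
  have hδ0 : 0 ≤ δ := (abs_nonneg _).trans (hδ x)
  exact mul_le_mul (hδ x) (by linarith) h0 hδ0

theorem abs_infDist_sub_le_hausdorffDist (hA : Bornology.IsBounded A) (hAn : A.Nonempty)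
    (hB : Bornology.IsBounded B) (hBn : B.Nonempty) (x : Euc d) :
    |Metric.infDist x A - Metric.infDist x B| ≤ Metric.hausdorffDist A B := by
  have hfin := Metric.hausdorffEDist_ne_top_of_nonempty_of_bounded hAn hBn hA hB
  have h1 := Metric.infDist_le_infDist_add_hausdorffDist (x := x) hfin
  rw [Metric.hausdorffEDist_comm] at hfin
  have h2 := Metric.infDist_le_infDist_add_hausdorffDist (x := x) hfin
  rw [Metric.hausdorffDist_comm] at h2
  rw [abs_le]
  constructor <;> linarith

theorem hausdorffDist_le_two_mul {ρ : ℝ} (hAn : A.Nonempty) (hAρ : A ⊆ Metric.closedBall 0 ρ)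
    (hBn : B.Nonempty) (hBρ : B ⊆ Metric.closedBall 0 ρ) :
    Metric.hausdorffDist A B ≤ 2 * ρ := by
  obtain ⟨a, ha⟩ := hAn
  obtain ⟨b, hb⟩ := hBn
  have hd : ∀ x ∈ A, ∀ y ∈ B, dist x y ≤ 2 * ρ := by
    intro x hx y hy
    have h1 := mem_closedBall_zero_iff.1 (hAρ hx)
    have h2 := mem_closedBall_zero_iff.1 (hBρ hy)
    rw [dist_eq_norm]
    linarith [norm_sub_le x y]
  refine Metric.hausdorffDist_le_of_mem_dist (dist_nonneg.trans (hd a ha b hb))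
    (fun x hx => ⟨b, hb, hd x hx b hb⟩) (fun y hy => ⟨a, ha, ?_⟩)
  rw [dist_comm]
  exact hd a ha y hy

theorem norm_le_sum_abs (v : Euc d) : ‖v‖ ≤ ∑ i, |v i| := by
  conv_lhs => rw [← (EuclideanSpace.basisFun (Fin d) ℝ).sum_repr v]
  refine (norm_sum_le _ _).trans (Finset.sum_le_sum fun i _ => ?_)
  rw [norm_smul]
  simp

/-- The metric projection depends Hölder continuously with exponent `1/2` on the set, in the
`L¹`-norm on a ball. -/
theorem exists_integral_norm_metricProj_sub_le (d : ℕ) {ρ r : ℝ} (hρ0 : 0 ≤ ρ)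
    (hr : Real.sqrt (2 * ρ) ≤ r) :
    ∃ C : ℝ, 0 ≤ C ∧ ∀ A B : Set (Euc d), IsClosed A → A.Nonempty → A ⊆ Metric.closedBall 0 ρ →
      IsClosed B → B.Nonempty → B ⊆ Metric.closedBall 0 ρ → 0 < Metric.hausdorffDist A B →
      ∫ x in Metric.closedBall 0 r, ‖metricProj A x - metricProj B x‖ ≤
        C * Real.sqrt (Metric.hausdorffDist A B) := by
  have hr0 : 0 ≤ r := (Real.sqrt_nonneg _).trans hr
  set ω := volume.real (Metric.ball (0 : Euc d) 1) with hω
  have hω0 : 0 ≤ ω := measureReal_nonneg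
  set C₁ : ℝ := 2 * ρ * (ω * (2 * d * (2 * r) ^ (d - 1))) with hC₁
  set C₂ : ℝ := 2 * (2 * r + ρ) * (r ^ d * ω) with hC₂
  refine ⟨d * (2 * C₁ + C₂), by positivity, fun A B hA hAn hAρ hB hBn hBρ hδ0 => ?_⟩
  set δ := Metric.hausdorffDist A B with hδ
  -- This step length balances the oscillation term O(t) against O(δ/t). The assumption on r ensures
  -- t ≤ r, since δ ≤ 2ρ.
  set t := Real.sqrt δ with ht
  have ht0 : 0 < t := Real.sqrt_pos.2 hδ0
  have htr : t ≤ r :=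
    (Real.sqrt_le_sqrt (hausdorffDist_le_two_mul hAn hAρ hBn hBρ)).trans hr
  have htt : δ = t * t := (Real.mul_self_sqrt hδ0.le).symm
  have hdd : ∀ x, |Metric.infDist x A - Metric.infDist x B| ≤ δ :=
    abs_infDist_sub_le_hausdorffDist (Metric.isBounded_closedBall.subset hAρ) hAn
      (Metric.isBounded_closedBall.subset hBρ) hBn
  have hcoord : ∀ i : Fin d, IntegrableOn (fun x => |(metricProj A x - metricProj B x) i|)
        (Metric.closedBall 0 r) ∧
      ∫ x in Metric.closedBall 0 r, |(metricProj A x - metricProj B x) i| ≤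
        (2 * C₁ + C₂) * t := by
    intro i
    set e : Euc d := EuclideanSpace.single i 1 with he
    have he1 : ‖e‖ = 1 := by simp [he]
    have hei : ∀ v : Euc d, v i = inner ℝ v e := fun v => by
      simp [he, EuclideanSpace.inner_single_right]
    have hiA := fun w => integrableOn_inner_metricProj_add hA hAn hAρ he1 w 0 r
    have hiB := fun w => integrableOn_inner_metricProj_add hB hBn hBρ he1 w 0 r
    have hi : IntegrableOn (fun x => |(inner ℝ (metricProj A x) e : ℝ) -
        inner ℝ (metricProj B x) e|) (Metric.closedBall 0 r) := by
      have h := (hiA 0).sub (hiB 0)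
      simp only [add_zero] at h
      exact h.abs
    have heq : (fun x => |(metricProj A x - metricProj B x) i|) = fun x =>
        |(inner ℝ (metricProj A x) e : ℝ) - inner ℝ (metricProj B x) e| := by
      ext x
      rw [hei, inner_sub_left]
    rw [heq]
    refine ⟨hi, ?_⟩
    have hIA := (hiA (t • e)).sub (hiA ((-t) • e))
    have hIB := (hiB (t • e)).sub (hiB ((-t) • e))
    have hIc : IntegrableOn (fun _ : Euc d => 2 * (2 * r + ρ) * t) (Metric.closedBall 0 r) :=
      integrableOn_const measure_closedBall_lt_top.ne
    refine (setIntegral_mono_on hi ((hIA.add hIB).add hIc)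
      Metric.isClosed_closedBall.measurableSet fun x hx => ?_).trans ?_
    · have h := abs_inner_metricProj_sub_le hA hAn hB hBn (η := δ * (2 * (2 * r + ρ))) ht0 x e
        fun s hs => ?_
      · have h' : δ * (2 * (2 * r + ρ)) / t = 2 * (2 * r + ρ) * t := by
          rw [htt]; field_simp
        rw [h'] at h
        exact h
      · refine (abs_projPotential_sub_le hAn hAρ hBn hBρ hdd _).trans ?_
        have hs' : |s| ≤ t := by
          rcases hs with rfl | rfl | rfl
          · simpa using ht0.le
          · rw [abs_of_pos ht0]
          · rw [abs_neg, abs_of_pos ht0]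
        have h1 : ‖x + s • e‖ ≤ r + t := by
          refine (norm_add_le _ _).trans (add_le_add (mem_closedBall_zero_iff.1 hx) ?_)
          rw [norm_smul, he1, mul_one]
          exact hs'
        gcongr
        linarith
    · simp only [Pi.add_apply, Pi.sub_apply]
      have h5 := integral_add (hIA.add hIB) hIc
      have h6 := integral_add hIA hIB
      simp only [Pi.add_apply, Pi.sub_apply] at h5 h6
      rw [h5, h6, setIntegral_const, volume_real_closedBall_zero d hr0]
      have h1 := integral_inner_metricProj_sub_le hA hAn hAρ he1 ht0.le htr
      have h2 := integral_inner_metricProj_sub_le hB hBn hBρ he1 ht0.le htr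
      have h3 : 2 * ρ * (ω * (2 * t * d * (2 * r) ^ (d - 1))) = C₁ * t := by rw [hC₁]; ring
      rw [← hω, h3] at h1 h2
      have h4 : (r ^ d * ω) • (2 * (2 * r + ρ) * t) = C₂ * t := by
        rw [hC₂, smul_eq_mul]; ring
      rw [← hω, h4]
      linarith
  have hsum : IntegrableOn (fun x => ∑ i, |(metricProj A x - metricProj B x) i|)
      (Metric.closedBall 0 r) := integrable_finsetSum _ fun i _ => (hcoord i).1
  have hmeas : AEStronglyMeasurable (fun x => ‖metricProj A x - metricProj B x‖)
      (volume.restrict (Metric.closedBall 0 r)) :=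
    (((aemeasurable_metricProj hA hAn).sub
      (aemeasurable_metricProj hB hBn)).norm).aestronglyMeasurable.restrict
  calc ∫ x in Metric.closedBall 0 r, ‖metricProj A x - metricProj B x‖
      ≤ ∫ x in Metric.closedBall 0 r, ∑ i, |(metricProj A x - metricProj B x) i| :=
        integral_mono_of_nonneg (Eventually.of_forall fun x => norm_nonneg _) hsum
          (Eventually.of_forall fun x => norm_le_sum_abs _)
    _ = ∑ i, ∫ x in Metric.closedBall 0 r, |(metricProj A x - metricProj B x) i| :=
        integral_finsetSum _ fun i _ => (hcoord i).1
    _ ≤ ∑ _i : Fin d, (2 * C₁ + C₂) * t := Finset.sum_le_sum fun i _ => (hcoord i).2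
    _ = d * (2 * C₁ + C₂) * t := by simp; ring

end Holder

/-! ### Dependence of the Voronoi tensor on the set -/

section Stability

variable {d : ℕ} {A B : Set (Euc d)}

theorem mem_cthickening_iff_infDist_le {R : ℝ} (hR : 0 ≤ R) (hne : A.Nonempty) {x : Euc d} :
    x ∈ Metric.cthickening R A ↔ Metric.infDist x A ≤ R := by
  rw [Metric.mem_cthickening_iff, Metric.infDist,
    ← ENNReal.le_ofReal_iff_toReal_le (Metric.infEDist_ne_top hne) hR]

/-- The integrand of the Voronoi tensor. -/
noncomputable def projTensor {d : ℕ} (r s : ℕ) (A : Set (Euc d)) (x : Euc d) : Tensor d (r + s) :=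
  symPowMul r s (metricProj A x) (x - metricProj A x)

theorem aestronglyMeasurable_projTensor (r s : ℕ) (hA : IsClosed A) (hne : A.Nonempty) :
    AEStronglyMeasurable (projTensor r s A) volume := by
  have hp := (aemeasurable_metricProj hA hne).aestronglyMeasurable
  have hq : AEStronglyMeasurable (fun x => (metricProj A x, x - metricProj A x)) volume :=
    hp.prodMk (aestronglyMeasurable_id.sub hp)
  have h := (continuous_symPowMul d r s).comp_aestronglyMeasurable hq
  unfold projTensor
  exact h

/-- `M` bounds the values and `L` is a Lipschitz constant of `symPowMul r s` on the ball of
radius `B`. -/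
def SymPowMulBounds (d r s : ℕ) (B L M : ℝ) : Prop :=
  ∀ x u : Euc d, ‖x‖ ≤ B → ‖u‖ ≤ B → ‖symPowMul r s x u‖ ≤ M ∧
    ∀ y v : Euc d, ‖y‖ ≤ B → ‖v‖ ≤ B →
      ‖symPowMul r s x u - symPowMul r s y v‖ ≤ L * (‖x - y‖ + ‖u - v‖)

theorem norm_projTensor_le {r s : ℕ} {ρ R L M : ℝ} (hb : SymPowMulBounds d r s (ρ + R) L M)
    (hR : 0 ≤ R) (hA : IsClosed A) (hne : A.Nonempty) (hρ : A ⊆ Metric.closedBall 0 ρ)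
    {x : Euc d} (hx : Metric.infDist x A ≤ R) : ‖projTensor r s A x‖ ≤ M := by
  have h1 := mem_closedBall_zero_iff.1 (hρ (metricProj_mem hA hne x))
  have h2 := norm_sub_metricProj hA hne x
  have h0 := norm_nonneg (metricProj A x)
  exact (hb _ _ (by linarith) (by linarith)).1

theorem norm_projTensor_sub_le {r s : ℕ} {ρ R L M : ℝ}
    (hb : SymPowMulBounds d r s (ρ + R) L M) (hR : 0 ≤ R)
    (hA : IsClosed A) (hAn : A.Nonempty) (hAρ : A ⊆ Metric.closedBall 0 ρ)
    (hB : IsClosed B) (hBn : B.Nonempty) (hBρ : B ⊆ Metric.closedBall 0 ρ) {x y : Euc d}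
    (hx : Metric.infDist x A ≤ R) (hy : Metric.infDist y B ≤ R) :
    ‖projTensor r s A x - projTensor r s B y‖ ≤ L * (‖metricProj A x - metricProj B y‖ +
      ‖x - metricProj A x - (y - metricProj B y)‖) := by
  have h1 := mem_closedBall_zero_iff.1 (hAρ (metricProj_mem hA hAn x))
  have h2 := norm_sub_metricProj hA hAn x
  have h3 := mem_closedBall_zero_iff.1 (hBρ (metricProj_mem hB hBn y))
  have h4 := norm_sub_metricProj hB hBn y
  have h0 := norm_nonneg (metricProj A x)
  exact (hb _ _ (by linarith) (by linarith)).2 _ _ (by linarith) (by linarith)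

theorem volume_cthickening_lt_top {ρ R : ℝ} (hρ : A ⊆ Metric.closedBall 0 ρ) :
    volume (Metric.cthickening R A) < ⊤ :=
  (Metric.isBounded_closedBall.subset hρ).cthickening.measure_lt_top

theorem integrableOn_projTensor {r s : ℕ} {ρ R L M : ℝ}
    (hb : SymPowMulBounds d r s (ρ + R) L M) (hR : 0 ≤ R) (hA : IsClosed A) (hne : A.Nonempty)
    (hρ : A ⊆ Metric.closedBall 0 ρ) :
    IntegrableOn (projTensor r s A) (Metric.cthickening R A) := by
  refine Measure.integrableOn_of_bounded (volume_cthickening_lt_top hρ).ne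
    (aestronglyMeasurable_projTensor r s hA hne) (M := M) ?_
  filter_upwards [ae_restrict_mem Metric.isClosed_cthickening.measurableSet] with x hx
  exact norm_projTensor_le hb hR hA hne hρ ((mem_cthickening_iff_infDist_le hR hne).1 hx)

theorem measurableSet_closedShell (A : Set (Euc d)) (r t : ℝ) :
    MeasurableSet {x : Euc d | r ≤ Metric.infDist x A ∧ Metric.infDist x A ≤ t} :=
  (measurableSet_le measurable_const (Metric.continuous_infDist_pt A).measurable).inter
    (measurableSet_le (Metric.continuous_infDist_pt A).measurable measurable_const)

theorem volume_closedShell_lt_top {ρ : ℝ} (hA : IsClosed A) (hne : A.Nonempty)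
    (hρ : A ⊆ Metric.closedBall 0 ρ) (r t : ℝ) :
    volume {x : Euc d | r ≤ Metric.infDist x A ∧ Metric.infDist x A ≤ t} < ⊤ :=
  (measure_mono (t := Metric.closedBall 0 (t + ρ)) fun x hx => mem_closedBall_zero_iff.2
    ((norm_le_infDist_add hA hne hρ x).trans (by linarith [hx.2]))).trans_lt
      measure_closedBall_lt_top

/-- A single majorant handles both a change of integrand and a change of domain; this serves the
comparison of two sets as well as the discretization. -/
theorem norm_setIntegral_sub_setIntegral_le {X F : Type*} [MeasurableSpace X] {μ : Measure X}
    [NormedAddCommGroup F] [NormedSpace ℝ F] {f g : X → F} {S T : Set X} (hS : MeasurableSet S)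
    (hT : MeasurableSet T) (hf : IntegrableOn f S μ) (hg : IntegrableOn g T μ) {h : X → ℝ}
    (hh : Integrable h μ) (h0 : ∀ x, 0 ≤ h x) (hST : ∀ᵐ x ∂μ, x ∈ S → x ∈ T → ‖f x - g x‖ ≤ h x)
    (hfS : ∀ x ∈ S, x ∉ T → ‖f x‖ ≤ h x) (hgT : ∀ x ∈ T, x ∉ S → ‖g x‖ ≤ h x) :
    ‖(∫ x in S, f x ∂μ) - ∫ x in T, g x ∂μ‖ ≤ ∫ x, h x ∂μ := by
  rw [← integral_indicator hS, ← integral_indicator hT, ← integral_sub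
    (hf.integrable_indicator hS) (hg.integrable_indicator hT)]
  refine norm_integral_le_of_norm_le hh ?_
  filter_upwards [hST] with x hx
  by_cases hxS : x ∈ S <;> by_cases hxT : x ∈ T <;> simp [hxS, hxT, h0]
  · exact hx hxS hxT
  · exact hfS x hxS hxT
  · exact hgT x hxT hxS

theorem norm_voronoiTensor_sub_le {r s : ℕ} {ρ R L M : ℝ}
    (hb : SymPowMulBounds d r s (ρ + R) L M) (hL : 0 ≤ L) (hM : 0 ≤ M) (hR : 0 ≤ R)
    (hA : IsClosed A) (hAn : A.Nonempty) (hAρ : A ⊆ Metric.closedBall 0 ρ)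
    (hB : IsClosed B) (hBn : B.Nonempty) (hBρ : B ⊆ Metric.closedBall 0 ρ)
    {δ : ℝ} (hδ : ∀ x, |Metric.infDist x A - Metric.infDist x B| ≤ δ) {r' : ℝ}
    (hr' : ρ + R ≤ r') :
    ‖voronoiTensor r s R A - voronoiTensor r s R B‖ ≤
      2 * L * (∫ x in Metric.closedBall 0 r', ‖metricProj A x - metricProj B x‖) +
        M * volume.real {x | R - δ ≤ Metric.infDist x B ∧ Metric.infDist x B ≤ R + δ} := by
  set S : Set (Euc d) := {x | R - δ ≤ Metric.infDist x B ∧ Metric.infDist x B ≤ R + δ} with hS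
  have hSm : MeasurableSet S := measurableSet_closedShell B _ _
  have hcm : ∀ D : Set (Euc d), MeasurableSet (Metric.cthickening R D) := fun D =>
    Metric.isClosed_cthickening.measurableSet
  have hbm : MeasurableSet (Metric.closedBall (0 : Euc d) r') :=
    Metric.isClosed_closedBall.measurableSet
  have hpi : IntegrableOn (fun x => ‖metricProj A x - metricProj B x‖)
      (Metric.closedBall 0 r') := by
    refine Measure.integrableOn_of_bounded measure_closedBall_lt_top.ne
      (((aemeasurable_metricProj hA hAn).sub
        (aemeasurable_metricProj hB hBn)).norm).aestronglyMeasurable (M := ρ + ρ) ?_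
    refine Eventually.of_forall fun x => ?_
    rw [norm_norm]
    exact (norm_sub_le _ _).trans
      (add_le_add (mem_closedBall_zero_iff.1 (hAρ (metricProj_mem hA hAn x)))
        (mem_closedBall_zero_iff.1 (hBρ (metricProj_mem hB hBn x))))
  have hi1 := (integrable_indicator_iff hbm).2 (hpi.const_mul (2 * L))
  have hi2 : Integrable (S.indicator fun _ => M) volume :=
    (integrableOn_const (volume_closedShell_lt_top hB hBn hBρ _ _).ne).integrable_indicator hSm
  have h1 : ∀ x, 0 ≤ (Metric.closedBall 0 r').indicator
      (fun x => 2 * L * ‖metricProj A x - metricProj B x‖) x := fun x =>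
    Set.indicator_nonneg (fun x _ => by positivity) x
  have h2 : ∀ x, 0 ≤ S.indicator (fun _ => M) x := fun x =>
    Set.indicator_nonneg (fun x _ => hM) x
  refine (norm_setIntegral_sub_setIntegral_le (hcm A) (hcm B)
    (integrableOn_projTensor hb hR hA hAn hAρ) (integrableOn_projTensor hb hR hB hBn hBρ)
    (hi1.add hi2) (fun x => add_nonneg (h1 x) (h2 x))
    (Eventually.of_forall fun x hxA hxB => ?_)
    (fun x hxA hxB => ?_) fun x hxB hxA => ?_).trans ?_
  · rw [mem_cthickening_iff_infDist_le hR hAn] at hxA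
    rw [mem_cthickening_iff_infDist_le hR hBn] at hxB
    have hxr : x ∈ Metric.closedBall (0 : Euc d) r' := mem_closedBall_zero_iff.2 <|
      (norm_le_infDist_add hA hAn hAρ x).trans (by linarith)
    rw [Pi.add_apply, Set.indicator_of_mem hxr]
    have h3 := norm_projTensor_sub_le hb hR hA hAn hAρ hB hBn hBρ hxA hxB
    -- The vectors x - p_A(x) and x - p_B(x) differ by as much as the projections do, whence the
    -- factor 2L.
    rw [sub_sub_sub_cancel_left, norm_sub_rev (metricProj B x)] at h3
    linarith [h2 x]
  · rw [mem_cthickening_iff_infDist_le hR hAn] at hxA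
    rw [mem_cthickening_iff_infDist_le hR hBn, not_le] at hxB
    have hx := abs_le.1 (hδ x)
    have hxS : x ∈ S := ⟨by linarith, by linarith⟩
    rw [Pi.add_apply, Set.indicator_of_mem hxS]
    linarith [norm_projTensor_le hb hR hA hAn hAρ hxA, h1 x]
  · rw [mem_cthickening_iff_infDist_le hR hBn] at hxB
    rw [mem_cthickening_iff_infDist_le hR hAn, not_le] at hxA
    have hx := abs_le.1 (hδ x)
    have hxS : x ∈ S := ⟨by linarith, by linarith⟩
    rw [Pi.add_apply, Set.indicator_of_mem hxS]
    linarith [norm_projTensor_le hb hR hB hBn hBρ hxB, h1 x]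
  · rw [integral_add' hi1 hi2, integral_indicator hbm, integral_indicator hSm,
      integral_const_mul, setIntegral_const, smul_eq_mul, mul_comm M]

theorem eq_of_hausdorffDist_eq_zero (hA : IsClosed A) (hAb : Bornology.IsBounded A)
    (hAn : A.Nonempty) (hB : IsClosed B) (hBb : Bornology.IsBounded B) (hBn : B.Nonempty)
    (h : Metric.hausdorffDist A B = 0) : A = B := by
  ext x
  have hx := abs_infDist_sub_le_hausdorffDist hAb hAn hBb hBn x
  rw [h, abs_nonpos_iff, sub_eq_zero] at hx
  rw [hA.mem_iff_infDist_zero hAn, hB.mem_iff_infDist_zero hBn, hx]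

/-- Voronoi tensors are Hölder continuous with exponent `1/2` with respect to the Hausdorff metric,
and the volume of the parallel set is Lipschitz. -/
theorem exists_norm_voronoiTensor_sub_le {d : ℕ} (hd : 1 ≤ d) (r s : ℕ) {R ρ : ℝ} (hR : 0 < R)
    (hρ0 : 0 ≤ ρ) :
    ∃ C : ℝ, 0 ≤ C ∧ ∀ A B : Set (Euc d), IsClosed A → A.Nonempty → A ⊆ Metric.closedBall 0 ρ →
      IsClosed B → B.Nonempty → B ⊆ Metric.closedBall 0 ρ →
      ‖voronoiTensor r s R A - voronoiTensor r s R B‖ ≤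
          C * Real.sqrt (Metric.hausdorffDist A B) ∧
        (r = 0 → s = 0 → ‖voronoiTensor r s R A - voronoiTensor r s R B‖ ≤
          C * Metric.hausdorffDist A B) := by
  obtain ⟨L, M, hL, hM, hL0, hb⟩ := exists_symPowMul_bounds d r s (by positivity : 0 ≤ ρ + R)
  obtain ⟨C₁, hC₁, h1⟩ := exists_integral_norm_metricProj_sub_le d
    (ρ := ρ) (r := ρ + R + Real.sqrt (2 * ρ)) hρ0 (by linarith)
  obtain ⟨C₂, hC₂, h2⟩ := exists_volume_shell_le d hR hρ0
  set C₃ := M * C₂ * (1 + (2 * ρ) ^ (d - 1)) with hC₃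
  have hC₃0 : 0 ≤ C₃ := by positivity
  refine ⟨2 * L * C₁ + C₃ * (1 + Real.sqrt (2 * ρ)), by positivity,
    fun A B hA hAn hAρ hB hBn hBρ => ?_⟩
  set δ := Metric.hausdorffDist A B with hδ
  have hδ0 : 0 ≤ δ := Metric.hausdorffDist_nonneg
  -- The integral and shell estimates need δ > 0; for δ = 0 the two closed sets coincide.
  rcases eq_or_lt_of_le hδ0 with h0 | hpos
  · have := eq_of_hausdorffDist_eq_zero hA
      (Metric.isBounded_closedBall.subset hAρ) hAn hB (Metric.isBounded_closedBall.subset hBρ)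
      hBn h0.symm
    rw [this, ← h0, sub_self, norm_zero, Real.sqrt_zero, mul_zero]
    exact ⟨le_rfl, fun _ _ => le_rfl⟩
  have hδρ : δ ≤ 2 * ρ := hausdorffDist_le_two_mul hAn hAρ hBn hBρ
  have hdd : ∀ x, |Metric.infDist x A - Metric.infDist x B| ≤ δ :=
    abs_infDist_sub_le_hausdorffDist (Metric.isBounded_closedBall.subset hAρ) hAn
      (Metric.isBounded_closedBall.subset hBρ) hBn
  have key := norm_voronoiTensor_sub_le hb hL hM hR.le hA hAn hAρ hB hBn hBρ hdd
    (r' := ρ + R + Real.sqrt (2 * ρ)) (by linarith [Real.sqrt_nonneg (2 * ρ)])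
  have k1 := h1 A B hA hAn hAρ hB hBn hBρ hpos
  have k2 := h2 B hB hBn hBρ δ hpos
  -- As δ ≤ 2ρ and d ≥ 1, the power δᵈ is absorbed into a multiple of δ.
  have k3 : max δ (δ ^ d) ≤ (1 + (2 * ρ) ^ (d - 1)) * δ := by
    have hdd' : δ ^ d = δ ^ (d - 1) * δ := by rw [← pow_succ, Nat.sub_add_cancel hd]
    have h4 : δ ^ (d - 1) * δ ≤ (2 * ρ) ^ (d - 1) * δ := by gcongr
    have h5 : 0 ≤ (2 * ρ) ^ (d - 1) * δ := by positivity
    rw [add_mul, one_mul]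
    exact max_le (by linarith) (by rw [hdd']; linarith)
  have k4 : M * volume.real {x | R - δ ≤ Metric.infDist x B ∧ Metric.infDist x B ≤ R + δ} ≤
      C₃ * δ := by
    calc _ ≤ M * (C₂ * ((1 + (2 * ρ) ^ (d - 1)) * δ)) := by gcongr; exact k2.trans (by gcongr)
      _ = C₃ * δ := by rw [hC₃]; ring
  have k5 : 2 * L * (∫ x in Metric.closedBall 0 (ρ + R + Real.sqrt (2 * ρ)),
      ‖metricProj A x - metricProj B x‖) ≤ 2 * L * C₁ * Real.sqrt δ := by
    rw [mul_assoc _ C₁]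
    gcongr
  refine ⟨?_, fun hr hs => ?_⟩
  · have k6 : δ ≤ Real.sqrt (2 * ρ) * Real.sqrt δ := by
      calc δ = Real.sqrt δ * Real.sqrt δ := (Real.mul_self_sqrt hδ0).symm
        _ ≤ _ := by gcongr
    have k7 := mul_le_mul_of_nonneg_left k6 hC₃0
    have k8 : 0 ≤ C₃ * Real.sqrt δ := by positivity
    calc _ ≤ 2 * L * C₁ * Real.sqrt δ + C₃ * δ := by linarith
      _ ≤ _ := by linarith
  · have hL' := hL0 hr hs
    subst hL'
    have k8 : 0 ≤ C₃ * Real.sqrt (2 * ρ) * δ := by positivity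
    linarith

end Stability

/-! ### Voronoi cells and jumps of the projection onto a finite set -/

section VoronoiCell

variable {d : ℕ} {A : Set (Euc d)}

/-- The closed Voronoi cell of `x` with respect to `A`, intersected with the ball of radius `R`
around `x`. -/
def voronoiCell (A : Set (Euc d)) (R : ℝ) (x : Euc d) : Set (Euc d) :=
  {z | dist z x ≤ R ∧ ∀ y ∈ A, dist z x ≤ dist z y}

theorem isCompact_voronoiCell (A : Set (Euc d)) (R : ℝ) (x : Euc d) :
    IsCompact (voronoiCell A R x) := by
  refine Metric.isCompact_of_isClosed_isBounded ?_
    (Metric.isBounded_closedBall.subset fun z hz => Metric.mem_closedBall.2 hz.1)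
  have h : voronoiCell A R x =
      {z | dist z x ≤ R} ∩ ⋂ y ∈ A, {z | dist z x ≤ dist z y} := by
    ext z
    simp [voronoiCell]
  rw [h]
  refine (isClosed_le (by fun_prop) (by fun_prop)).inter ?_
  exact isClosed_biInter fun y _ => isClosed_le (by fun_prop) (by fun_prop)

/-- Squaring cancels ‖z‖², so each comparison of distances describes a half-space. -/
theorem convex_voronoiCell (A : Set (Euc d)) (R : ℝ) (x : Euc d) :
    Convex ℝ (voronoiCell A R x) := by
  have h : voronoiCell A R x = Metric.closedBall x R ∩
      ⋂ y ∈ A, {z | innerSL ℝ ((2 : ℝ) • (y - x)) z ≤ ‖y‖ ^ 2 - ‖x‖ ^ 2} := by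
    ext z
    simp only [voronoiCell, Set.mem_ofPred_eq, Set.mem_inter_iff, Metric.mem_closedBall,
      Set.mem_iInter, innerSL_apply_apply]
    refine and_congr Iff.rfl (forall₂_congr fun y _ => ?_)
    rw [dist_eq_norm, dist_eq_norm, ← sq_le_sq₀ (norm_nonneg _) (norm_nonneg _),
      norm_sub_sq_real, norm_sub_sq_real, real_inner_smul_left, inner_sub_left,
      real_inner_comm z, real_inner_comm z]
    constructor <;> intro h <;> linarith
  rw [h]
  exact (convex_closedBall x R).inter (convex_iInter₂ fun y _ =>
    convex_halfSpace_le (innerSL ℝ ((2 : ℝ) • (y - x))).toLinearMap.isLinear _)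

theorem mem_homothety_image_iff {x y : Euc d} {c : ℝ} (hc : 0 < c) {D : Set (Euc d)} :
    y ∈ AffineMap.homothety x c '' D ↔ x + c⁻¹ • (y - x) ∈ D := by
  constructor
  · rintro ⟨z, hz, rfl⟩
    simp only [AffineMap.homothety_apply, vsub_eq_sub, vadd_eq_add, add_sub_cancel_right, smul_smul]
    rw [inv_mul_cancel₀ hc.ne', one_smul, add_sub_cancel]
    exact hz
  · intro h
    refine ⟨_, h, ?_⟩
    simp only [AffineMap.homothety_apply, vsub_eq_sub, vadd_eq_add, add_sub_cancel_left, smul_smul]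
    rw [mul_inv_cancel₀ hc.ne', one_smul, sub_add_cancel]

theorem Convex.subset_homothety_image {D : Set (Euc d)} (hD : Convex ℝ D) {x : Euc d}
    (hx : x ∈ D) {c : ℝ} (hc : 1 ≤ c) : D ⊆ AffineMap.homothety x c '' D := by
  intro y hy
  rw [mem_homothety_image_iff (by linarith)]
  exact hD.add_smul_sub_mem hx hy ⟨by positivity, inv_le_one_of_one_le₀ hc⟩

/-- The `ε`-neighbourhood of a convex set that contains a ball around `x` of radius `m` lies in the
dilation of the set around `x` by the factor `1 + ε / m`. -/
theorem Convex.mem_homothety_image {D : Set (Euc d)} (hD : Convex ℝ D) {x : Euc d} {m ε : ℝ}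
    (hm : 0 < m) (hε : 0 < ε) (hball : Metric.closedBall x m ⊆ D) {w y : Euc d} (hw : w ∈ D)
    (hyw : dist y w ≤ ε) : y ∈ AffineMap.homothety x (1 + ε / m) '' D := by
  have hc : 0 < 1 + ε / m := by positivity
  rw [mem_homothety_image_iff hc]
  -- The displacement y - w is rescaled to fit into the ball; the contracted image of y is then a
  -- convex combination of w and v.
  set v : Euc d := x + (m / ε) • (y - w) with hv
  have hvD : v ∈ D := by
    refine hball (mem_closedBall_iff_norm.2 ?_)
    rw [hv, add_sub_cancel_left, norm_smul, Real.norm_of_nonneg (by positivity), ← dist_eq_norm]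
    calc m / ε * dist y w ≤ m / ε * ε := by gcongr
      _ = m := by field_simp
  have h := hD hw hvD (a := (1 + ε / m)⁻¹) (b := 1 - (1 + ε / m)⁻¹) (by positivity)
    (sub_nonneg.2 (inv_le_one_of_one_le₀ (by linarith [div_pos hε hm]))) (by ring)
  have hb : (1 - (1 + ε / m)⁻¹) * (m / ε) = (1 + ε / m)⁻¹ := by
    field_simp
    ring
  have heq : x + (1 + ε / m)⁻¹ • (y - x) =
      (1 + ε / m)⁻¹ • w + (1 - (1 + ε / m)⁻¹) • v := by
    rw [hv, smul_add, smul_smul, hb, sub_smul, one_smul, smul_sub, smul_sub]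
    abel
  rw [heq]
  exact h

theorem closedBall_subset_voronoiCell {R m : ℝ} {x : Euc d} (hx : x ∈ A)
    (hmR : m ≤ R) (hmA : 2 * m ≤ A.infsep) : Metric.closedBall x m ⊆ voronoiCell A R x := by
  intro z hz
  rw [Metric.mem_closedBall] at hz
  refine ⟨hz.trans hmR, fun y hy => ?_⟩
  rcases eq_or_ne x y with rfl | hxy
  · exact le_rfl
  · have h1 := Set.infsep_le_dist_of_mem hx hy hxy
    have h2 := dist_triangle_left x y z
    linarith

theorem volume_real_homothety_sdiff {D : Set (Euc d)} (hD : Convex ℝ D) (hDc : IsCompact D)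
    {x : Euc d} (hx : x ∈ D) {c : ℝ} (hc : 1 ≤ c) :
    volume.real (AffineMap.homothety x c '' D \ D) = (c ^ d - 1) * volume.real D := by
  have hc0 : 0 ≤ c := by linarith
  have himg : volume (AffineMap.homothety x c '' D) = ENNReal.ofReal (c ^ d) * volume D := by
    rw [Measure.addHaar_image_homothety, finrank_euclideanSpace_fin, abs_of_nonneg (by positivity)]
  rw [measureReal_sdiff (hD.subset_homothety_image hx hc) hDc.measurableSet
    (hDc.image (AffineMap.homothety_continuous x c)).measure_lt_top.ne, measureReal_def, himg, ENNReal.toReal_mul,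
    ENNReal.toReal_ofReal (by positivity), sub_mul, one_mul]
  rfl

theorem dist_eq_infDist_of_mem_voronoiCell {R : ℝ} {x z : Euc d}
    (hx : x ∈ A) (hz : z ∈ voronoiCell A R x) : dist z x = Metric.infDist z A :=
  le_antisymm ((Metric.le_infDist ⟨x, hx⟩).2 fun {y} hy => hz.2 y hy)
    (Metric.infDist_le_dist_of_mem hx)

theorem mem_voronoiCell_metricProj {R : ℝ} {z : Euc d} (hA : IsClosed A) (hne : A.Nonempty)
    (hz : Metric.infDist z A ≤ R) : z ∈ voronoiCell A R (metricProj A z) := by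
  have h := (metricProj_spec hA hne z).2
  exact ⟨h.trans_le hz, fun y hy => h.trans_le (Metric.infDist_le_dist_of_mem hy)⟩

/-- Up to a null set, the points of `A^R` whose projection changes under some displacement of
length at most `ε` lie in a set of small volume. -/
theorem exists_projection_jump_set (hA : A.Finite) (hne : A.Nonempty) {ρ R ε m : ℝ}
    (hρ : A ⊆ Metric.closedBall 0 ρ) (hε : 0 < ε) (hm : 0 < m) (hmR : m ≤ R)
    (hmA : 2 * m ≤ A.infsep) :
    ∃ E : Set (Euc d), MeasurableSet E ∧ volume E < ⊤ ∧
      volume.real E ≤ ((1 + ε / m) ^ d - 1) * volume.real (Metric.cthickening R A) ∧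
      ∀ᵐ y : Euc d, ∀ w, dist y w ≤ ε → Metric.infDist w A ≤ R →
        metricProj A w ≠ metricProj A y → y ∈ E := by
  set c := 1 + ε / m with hc
  have hc1 : 1 ≤ c := by rw [hc]; linarith [div_pos hε hm]
  have hR : 0 ≤ R := hm.le.trans hmR
  have hcell : ∀ x ∈ A, Metric.closedBall x m ⊆ voronoiCell A R x := fun x hx =>
    closedBall_subset_voronoiCell hx hmR hmA
  have hxcell : ∀ x ∈ A, x ∈ voronoiCell A R x := fun x hx =>
    hcell x hx (Metric.mem_closedBall_self hm.le)
  have hcomp := isCompact_voronoiCell A R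
  have hcompI : ∀ x, IsCompact (AffineMap.homothety x c '' voronoiCell A R x) := fun x =>
    (hcomp x).image (AffineMap.homothety_continuous x c)
  -- The exceptional set is the union of these differences, each of volume (cᵈ - 1) times that of
  -- its cell.
  set G : Euc d → Set (Euc d) := fun x =>
    AffineMap.homothety x c '' voronoiCell A R x \ voronoiCell A R x with hG
  have hGm : ∀ x, MeasurableSet (G x) := fun x =>
    (hcompI x).measurableSet.diff (hcomp x).measurableSet
  have hGf : ∀ x, volume (G x) < ⊤ := fun x =>
    (measure_mono Set.sdiff_subset).trans_lt (hcompI x).measure_lt_top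
  refine ⟨⋃ x ∈ hA.toFinset, G x, Finset.measurableSet_biUnion _ fun x _ => hGm x,
    (measure_biUnion_finset_le _ _).trans_lt (ENNReal.sum_lt_top.2 fun x _ => hGf x), ?_, ?_⟩
  · have h1 : volume.real (⋃ x ∈ hA.toFinset, G x) ≤ ∑ x ∈ hA.toFinset, volume.real (G x) :=
      measureReal_biUnion_finset_le _ _
    have h2 : ∑ x ∈ hA.toFinset, volume.real (G x) =
        (c ^ d - 1) * ∑ x ∈ hA.toFinset, volume.real (voronoiCell A R x) := by
      rw [Finset.mul_sum]
      refine Finset.sum_congr rfl fun x hx => ?_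
      exact volume_real_homothety_sdiff (convex_voronoiCell A R x) (hcomp x)
        (hxcell x (hA.mem_toFinset.1 hx)) hc1
    -- Two closed cells meet only at points with two nearest points, which form a null set.
    have h3 : ∑ x ∈ hA.toFinset, volume.real (voronoiCell A R x) =
        volume.real (⋃ x ∈ hA.toFinset, voronoiCell A R x) := by
      simp only [measureReal_def]
      rw [measure_biUnion_finset₀ _ fun x _ => (hcomp x).measurableSet.nullMeasurableSet,
        ENNReal.toReal_sum fun x _ => (hcomp x).measure_lt_top.ne]
      intro x hx x' hx' hxx'
      refine measure_mono_null ?_ (ae_iff.1 (ae_nearest_unique hA.isClosed hne))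
      rintro z ⟨hz, hz'⟩ hu
      rw [Finset.mem_coe, hA.mem_toFinset] at hx hx'
      exact hxx' ((hu x hx (dist_eq_infDist_of_mem_voronoiCell hx hz)).trans
        (hu x' hx' (dist_eq_infDist_of_mem_voronoiCell hx' hz')).symm)
    have h4 : volume.real (⋃ x ∈ hA.toFinset, voronoiCell A R x) ≤
        volume.real (Metric.cthickening R A) := by
      refine measureReal_mono (Set.iUnion₂_subset fun x hx z hz => ?_)
        (volume_cthickening_lt_top hρ).ne
      rw [hA.mem_toFinset] at hx
      rw [mem_cthickening_iff_infDist_le hR hne]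
      exact (Metric.infDist_le_dist_of_mem hx).trans hz.1
    rw [h2, h3] at h1
    refine h1.trans (mul_le_mul_of_nonneg_left h4 (sub_nonneg.2 (one_le_pow₀ hc1)))
  -- Here y is ε-close to w, hence in the dilated cell of the projection of w. If y were in that
  -- cell itself, uniqueness of the nearest point would make the projections equal.
  · filter_upwards [ae_nearest_unique hA.isClosed hne] with y hy w hyw hw hne'
    have hx := metricProj_mem hA.isClosed hne w
    refine Set.mem_iUnion₂.2 ⟨metricProj A w, hA.mem_toFinset.2 hx, ?_, fun hyc => ?_⟩
    · exact (convex_voronoiCell A R _).mem_homothety_image hm hε (hcell _ hx)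
        (mem_voronoiCell_metricProj hA.isClosed hne hw) hyw
    · exact hne' (hy _ hx (dist_eq_infDist_of_mem_voronoiCell hx hyc))

end VoronoiCell

/-! ### The estimator as the integral of a step function -/

section Grid

variable {d : ℕ}

/-- The index of the cell of the grid `a ℤᵈ + u` that contains `y`. -/
noncomputable def gridIndex (a : ℝ) (u y : Euc d) : Fin d → ℤ := fun i => ⌊(y i - u i) / a⌋

theorem measurable_gridIndex (a : ℝ) (u : Euc d) : Measurable (gridIndex a u) := by
  refine measurable_pi_lambda _ fun i => Int.measurable_floor.comp ?_
  exact Measurable.div_const (Measurable.sub_const (by fun_prop) _) _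

theorem norm_gridPoint_gridIndex_sub_le {a : ℝ} (ha : 0 < a) (u y : Euc d) :
    ‖gridPoint a u (gridIndex a u y) - y‖ ≤ a * Real.sqrt d := by
  have hi : ∀ i, |(gridPoint a u (gridIndex a u y) - y) i| ≤ a := by
    intro i
    have h1 := Int.floor_le ((y i - u i) / a)
    have h2 := Int.lt_floor_add_one ((y i - u i) / a)
    rw [le_div_iff₀ ha] at h1
    rw [div_lt_iff₀ ha] at h2
    have h3 : (gridPoint a u (gridIndex a u y) - y) i =
        a * (⌊(y i - u i) / a⌋ : ℝ) + u i - y i := rfl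
    rw [h3, abs_le]
    constructor <;> linarith
  rw [EuclideanSpace.norm_eq]
  refine Real.sqrt_le_iff.2 ⟨by positivity, ?_⟩
  rw [mul_pow, Real.sq_sqrt (Nat.cast_nonneg d)]
  calc ∑ i, ‖(gridPoint a u (gridIndex a u y) - y) i‖ ^ 2 ≤ ∑ _i : Fin d, a ^ 2 :=
        Finset.sum_le_sum fun i _ => pow_le_pow_left₀ (norm_nonneg _) (hi i) 2
    _ = a ^ 2 * d := by simp [mul_comm]

theorem volume_gridIndex_preimage {a : ℝ} (ha : 0 < a) (u : Euc d) (z : Fin d → ℤ) :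
    volume (gridIndex a u ⁻¹' {z}) = ENNReal.ofReal (a ^ d) := by
  have h : gridIndex a u ⁻¹' {z} = (WithLp.ofLp : Euc d → Fin d → ℝ) ⁻¹'
      (Set.univ.pi fun i => Set.Ico (a * z i + u i) (a * z i + u i + a)) := by
    ext y
    simp only [Set.mem_preimage, Set.mem_singleton_iff, funext_iff, gridIndex, Int.floor_eq_iff,
      le_div_iff₀ ha, div_lt_iff₀ ha, Set.mem_pi, Set.mem_univ, true_imp_iff, Set.mem_Ico]
    refine forall_congr' fun i => and_congr ?_ ?_ <;> constructor <;> intro h <;> linarith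
  rw [h, (PiLp.volume_preserving_ofLp (Fin d)).measure_preimage
    (MeasurableSet.univ_pi fun i => measurableSet_Ico).nullMeasurableSet, Real.volume_pi_Ico]
  simp [ENNReal.ofReal_pow ha.le]

/-- The integrand is constant on each half-open grid cell, and each cell has volume aᵈ. -/
theorem integral_gridPoint {F : Type*} [NormedAddCommGroup F] [NormedSpace ℝ F] [CompleteSpace F]
    {a : ℝ} (ha : 0 < a) (u : Euc d) (f : Euc d → F)
    (hf : Integrable fun y => f (gridPoint a u (gridIndex a u y))) :
    ∫ y, f (gridPoint a u (gridIndex a u y)) = a ^ d • ∑' z, f (gridPoint a u z) := by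
  have hm := measurable_gridIndex a u
  have hs : StronglyMeasurable fun z => f (gridPoint a u z) := .of_discrete
  have hi : Integrable (fun z => f (gridPoint a u z)) (volume.map (gridIndex a u)) :=
    (integrable_map_measure hs.aestronglyMeasurable hm.aemeasurable).2 hf
  have h1 := integral_map (μ := volume) hm.aemeasurable hs.aestronglyMeasurable
  rw [← h1, integral_countable hi, ← tsum_const_smul'' (a ^ d)]
  refine tsum_congr fun z => ?_
  rw [measureReal_def, Measure.map_apply hm (measurableSet_singleton z),
    volume_gridIndex_preimage ha, ENNReal.toReal_ofReal (by positivity)]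

theorem abs_infDist_sub_le_norm (A : Set (Euc d)) (x y : Euc d) :
    |Metric.infDist x A - Metric.infDist y A| ≤ ‖x - y‖ := by
  have h := (Metric.lipschitz_infDist_pt A).dist_le_mul x y
  rwa [Real.dist_eq, NNReal.coe_one, one_mul, dist_eq_norm] at h

theorem voronoiEstimator_eq_setIntegral {r s : ℕ} {A : Set (Euc d)} {ρ R L M : ℝ}
    (hb : SymPowMulBounds d r s (ρ + R) L M) (hR : 0 ≤ R) (hA : IsClosed A) (hne : A.Nonempty)
    (hρ : A ⊆ Metric.closedBall 0 ρ) {a : ℝ} (ha : 0 < a) (u : Euc d) :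
    MeasurableSet {y | Metric.infDist (gridPoint a u (gridIndex a u y)) A < R} ∧
    IntegrableOn (fun y => projTensor r s A (gridPoint a u (gridIndex a u y)))
      {y | Metric.infDist (gridPoint a u (gridIndex a u y)) A < R} ∧
    voronoiEstimator r s R A a u =
      ∫ y in {y | Metric.infDist (gridPoint a u (gridIndex a u y)) A < R},
        projTensor r s A (gridPoint a u (gridIndex a u y)) := by
  set T := {y | Metric.infDist (gridPoint a u (gridIndex a u y)) A < R} with hT
  have hm := measurable_gridIndex a u
  have hTm : MeasurableSet T :=
    hm (Set.to_countable {z | Metric.infDist (gridPoint a u z) A < R}).measurableSet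
  have hTf : volume T < ⊤ := by
    refine (measure_mono (t := Metric.closedBall 0 (R + ρ + a * Real.sqrt d)) fun y hy => ?_).trans_lt
      measure_closedBall_lt_top
    have h1 := norm_gridPoint_gridIndex_sub_le ha u y
    have h2 := norm_le_infDist_add hA hne hρ (gridPoint a u (gridIndex a u y))
    have h3 := norm_le_norm_add_norm_sub (gridPoint a u (gridIndex a u y)) y
    have h4 : Metric.infDist (gridPoint a u (gridIndex a u y)) A < R := hy
    rw [mem_closedBall_zero_iff]
    linarith
  have hs : StronglyMeasurable fun z => projTensor r s A (gridPoint a u z) := .of_discrete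
  have hi : IntegrableOn (fun y => projTensor r s A (gridPoint a u (gridIndex a u y))) T := by
    refine Measure.integrableOn_of_bounded hTf.ne (hs.comp_measurable hm).aestronglyMeasurable
      (M := M) ?_
    filter_upwards [ae_restrict_mem hTm] with y hy
    exact norm_projTensor_le hb hR hA hne hρ (le_of_lt hy)
  refine ⟨hTm, hi, ?_⟩
  set f : Euc d → Tensor d (r + s) :=
    {x | Metric.infDist x A < R}.indicator (projTensor r s A) with hf
  have hfi : (fun y => f (gridPoint a u (gridIndex a u y))) =
      T.indicator fun y => projTensor r s A (gridPoint a u (gridIndex a u y)) := rfl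
  have h := integral_gridPoint ha u f (by
    rw [hfi]
    exact hi.integrable_indicator hTm)
  rw [← integral_indicator hTm, ← hfi, h, voronoiEstimator]
  congr 1
  refine tsum_congr fun z => ?_
  rw [norm_sub_metricProj hA hne]
  rfl

end Grid

/-! ### Discretization error and assembly of the bounds -/

/-- The three terms come from points whose grid corner has the same projection, from points near the
boundary of the parallel set, and from points where the projection jumps. -/
theorem norm_voronoiEstimator_sub_voronoiTensor_le {d r s : ℕ} {A : Set (Euc d)} {ρ R L M : ℝ}
    (hd : 1 ≤ d) (hb : SymPowMulBounds d r s (ρ + R) L M) (hL : 0 ≤ L) (hM : 0 ≤ M)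
    (hA : A.Finite) (hne : A.Nonempty) (hρ : A ⊆ Metric.closedBall 0 ρ) {m : ℝ}
    (hm : 0 < m) (hmR : m ≤ R) (hmA : 2 * m ≤ A.infsep) {a : ℝ} (ha : 0 < a) (u : Euc d) :
    ‖voronoiEstimator r s R A a u - voronoiTensor r s R A‖ ≤
      L * (a * Real.sqrt d) * volume.real (Metric.cthickening R A) +
        M * volume.real {x | R - a * Real.sqrt d ≤ Metric.infDist x A ∧
          Metric.infDist x A ≤ R + a * Real.sqrt d} +
        2 * M * (((1 + a * Real.sqrt d / m) ^ d - 1) *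
          volume.real (Metric.cthickening R A)) := by
  have hAc := hA.isClosed
  have hR : 0 ≤ R := hm.le.trans hmR
  set ε := a * Real.sqrt d with hε
  have hε0 : 0 < ε := mul_pos ha (Real.sqrt_pos.2 (by exact_mod_cast hd))
  set S : Set (Euc d) := {x | R - ε ≤ Metric.infDist x A ∧ Metric.infDist x A ≤ R + ε} with hS
  have hSm : MeasurableSet S := measurableSet_closedShell A _ _
  obtain ⟨E, hEm, hEf, hEv, hE⟩ := exists_projection_jump_set hA hne hρ hε0 hm hmR hmA
  have hKm : MeasurableSet (Metric.cthickening R A) := Metric.isClosed_cthickening.measurableSet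
  obtain ⟨hTm, hTi, hTe⟩ := voronoiEstimator_eq_setIntegral hb hR hAc hne hρ ha u
  have hconst : ∀ (D : Set (Euc d)) (c : ℝ), MeasurableSet D → volume D < ⊤ →
      Integrable (D.indicator fun _ => c) volume := fun D c hDm hDf =>
    (integrable_indicator_iff hDm).2 (integrableOn_const hDf.ne)
  have hi1 := hconst _ (L * ε) hKm (volume_cthickening_lt_top hρ)
  have hi2 := hconst S M hSm (volume_closedShell_lt_top hAc hne hρ _ _)
  have hi3 := hconst E (2 * M) hEm hEf
  have h1 : ∀ x, 0 ≤ (Metric.cthickening R A).indicator (fun _ => L * ε) x := fun x =>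
    Set.indicator_nonneg (fun x _ => by positivity) x
  have h2 : ∀ x, 0 ≤ S.indicator (fun _ => M) x := fun x =>
    Set.indicator_nonneg (fun x _ => hM) x
  have h3 : ∀ x, 0 ≤ E.indicator (fun _ => 2 * M) x := fun x =>
    Set.indicator_nonneg (fun x _ => by positivity) x
  have hdist := norm_gridPoint_gridIndex_sub_le ha u
  rw [hTe]
  refine (norm_setIntegral_sub_setIntegral_le hTm hKm hTi
    (integrableOn_projTensor hb hR hAc hne hρ) ((hi1.add hi2).add hi3)
    (fun x => add_nonneg (add_nonneg (h1 x) (h2 x)) (h3 x)) ?_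
    (fun x hxA hxB => ?_) fun x hxB hxA => ?_).trans ?_
  · filter_upwards [hE] with y hy hyT hyK
    have hyT' : Metric.infDist (gridPoint a u (gridIndex a u y)) A ≤ R := le_of_lt hyT
    have hyK' := (mem_cthickening_iff_infDist_le hR hne).1 hyK
    simp only [Pi.add_apply]
    rw [Set.indicator_of_mem hyK]
    by_cases hp : metricProj A (gridPoint a u (gridIndex a u y)) = metricProj A y
    · have h4 := norm_projTensor_sub_le hb hR hAc hne hρ hAc hne hρ hyT' hyK'
      -- With equal projections only the displacement to the grid corner survives.
      rw [hp, sub_self, norm_zero, zero_add, sub_sub_sub_cancel_right] at h4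
      have h5 := mul_le_mul_of_nonneg_left (hdist y) hL
      linarith [h2 y, h3 y]
    · have hyE := hy _ (by rw [dist_comm, dist_eq_norm]; exact hdist y) hyT' hp
      rw [Set.indicator_of_mem hyE]
      have h4 := norm_projTensor_le hb hR hAc hne hρ hyT'
      have h5 := norm_projTensor_le hb hR hAc hne hρ hyK'
      have h6 := norm_sub_le (projTensor r s A (gridPoint a u (gridIndex a u y)))
        (projTensor r s A y)
      have : 0 ≤ L * ε := by positivity
      linarith [h2 y]
  · have hxA' : Metric.infDist (gridPoint a u (gridIndex a u x)) A < R := hxA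
    rw [mem_cthickening_iff_infDist_le hR hne, not_le] at hxB
    have hx := abs_le.1 ((abs_infDist_sub_le_norm A _ _).trans (hdist x))
    have hxS : x ∈ S := ⟨by linarith, by linarith⟩
    simp only [Pi.add_apply]
    rw [Set.indicator_of_mem hxS]
    linarith [norm_projTensor_le hb hR hAc hne hρ hxA'.le, h1 x, h3 x]
  · have hxA' : R ≤ Metric.infDist (gridPoint a u (gridIndex a u x)) A := not_lt.1 hxA
    rw [mem_cthickening_iff_infDist_le hR hne] at hxB
    have hx := abs_le.1 ((abs_infDist_sub_le_norm A _ _).trans (hdist x))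
    have hxS : x ∈ S := ⟨by linarith, by linarith⟩
    simp only [Pi.add_apply]
    rw [Set.indicator_of_mem hxS]
    linarith [norm_projTensor_le hb hR hAc hne hρ hxB, h1 x, h3 x]
  · rw [integral_add' (hi1.add hi2) hi3, integral_add' hi1 hi2, integral_indicator hKm,
      integral_indicator hSm, integral_indicator hEm, setIntegral_const, setIntegral_const,
      setIntegral_const, smul_eq_mul, smul_eq_mul, smul_eq_mul]
    have h4 := mul_le_mul_of_nonneg_left hEv (by positivity : 0 ≤ 2 * M)
    linarith

/-- For t ≤ 1 the difference of powers is linear in t; for t > 1 one uses 1 + κt ≤ (1 + κ)t. -/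
theorem one_add_mul_pow_sub_one_le {κ t : ℝ} (hκ : 0 ≤ κ) (ht : 0 ≤ t) (d : ℕ) :
    (1 + κ * t) ^ d - 1 ≤ (κ * d * (1 + κ) ^ (d - 1) + (1 + κ) ^ d) * max t (t ^ d) := by
  have hm1 : t ≤ max t (t ^ d) := le_max_left _ _
  have hm2 : t ^ d ≤ max t (t ^ d) := le_max_right _ _
  have hm0 : 0 ≤ max t (t ^ d) := ht.trans hm1
  have ha : 0 ≤ κ * d * (1 + κ) ^ (d - 1) * max t (t ^ d) := by positivity
  have hb : 0 ≤ (1 + κ) ^ d * max t (t ^ d) := by positivity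
  rw [add_mul]
  rcases le_or_gt t 1 with h | h
  · have h1 := (le_abs_self _).trans (abs_pow_sub_pow_le (1 + κ * t) 1 d)
    have hκt : 0 ≤ κ * t := by positivity
    rw [one_pow, add_sub_cancel_left, abs_of_nonneg hκt, abs_one,
      abs_of_nonneg (by positivity : 0 ≤ 1 + κ * t), max_eq_left (by linarith)] at h1
    have h2 : κ * t * d * (1 + κ * t) ^ (d - 1) ≤ κ * d * (1 + κ) ^ (d - 1) * t := by
      have : (1 + κ * t) ^ (d - 1) ≤ (1 + κ) ^ (d - 1) :=
        pow_le_pow_left₀ (by positivity) (by nlinarith) _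
      calc _ ≤ κ * t * d * (1 + κ) ^ (d - 1) := by gcongr
        _ = _ := by ring
    have h3 := mul_le_mul_of_nonneg_left hm1
      (by positivity : 0 ≤ κ * d * (1 + κ) ^ (d - 1))
    linarith
  · have h1 : (1 + κ * t) ^ d ≤ (1 + κ) ^ d * t ^ d := by
      rw [← mul_pow]
      exact pow_le_pow_left₀ (by positivity) (by nlinarith) _
    have h2 := mul_le_mul_of_nonneg_left hm2 (by positivity : 0 ≤ (1 + κ) ^ d)
    linarith

theorem max_mul_pow_le {θ t : ℝ} (hθ : 0 ≤ θ) (ht : 0 ≤ t) (d : ℕ) :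
    max (θ * t) ((θ * t) ^ d) ≤ (θ + θ ^ d) * max t (t ^ d) := by
  have hm1 : t ≤ max t (t ^ d) := le_max_left _ _
  have hm2 : t ^ d ≤ max t (t ^ d) := le_max_right _ _
  have hm0 : 0 ≤ max t (t ^ d) := ht.trans hm1
  have h1 := mul_le_mul_of_nonneg_left hm1 hθ
  have h2 := mul_le_mul_of_nonneg_left hm2 (by positivity : 0 ≤ θ ^ d)
  have h3 := mul_nonneg hθ hm0
  have h4 : 0 ≤ θ ^ d * max t (t ^ d) := by positivity
  rw [add_mul, mul_pow]
  exact max_le (by linarith) (by linarith)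

theorem Set.Nontrivial.one_le_of_euc {d : ℕ} {A : Set (Euc d)} (hA : A.Nontrivial) : 1 ≤ d := by
  by_contra h
  obtain rfl : d = 0 := by omega
  obtain ⟨x, _, y, _, hxy⟩ := hA
  exact hxy (Subsingleton.elim x y)

theorem Set.Nontrivial.infsep_le_two_mul {d : ℕ} {A : Set (Euc d)} (hA : A.Nontrivial) {ρ : ℝ}
    (hρ : A ⊆ Metric.closedBall 0 ρ) : A.infsep ≤ 2 * ρ := by
  obtain ⟨x, hx, y, hy, hxy⟩ := hA
  have h := Set.infsep_le_dist_of_mem hx hy hxy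
  have h1 := mem_closedBall_zero_iff.1 (hρ hx)
  have h2 := mem_closedBall_zero_iff.1 (hρ hy)
  rw [dist_eq_norm] at h
  linarith [norm_sub_le x y]

theorem exists_norm_voronoiEstimator_sub_voronoiTensor_le (d r s : ℕ) {R ρ : ℝ} (hR : 0 < R)
    (hρ0 : 0 < ρ) :
    ∃ C : ℝ, 0 ≤ C ∧ ∀ A : Set (Euc d), A.Finite → A.Nontrivial →
      A ⊆ Metric.closedBall 0 ρ → ∀ a : ℝ, 0 < a → ∀ u : Euc d,
      ‖voronoiEstimator r s R A a u - voronoiTensor r s R A‖ ≤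
        C * max (a / A.infsep) ((a / A.infsep) ^ d) := by
  obtain ⟨L, M, hL, hM, -, hb⟩ := exists_symPowMul_bounds d r s (by positivity : 0 ≤ ρ + R)
  obtain ⟨C₁, hC₁, hshell⟩ := exists_volume_shell_le d hR hρ0.le
  set W := volume.real (Metric.closedBall (0 : Euc d) (ρ + R)) with hW
  have hW0 : 0 ≤ W := measureReal_nonneg
  -- The inscribed balls get radius m = c₀ N, with N the minimal separation: 2m ≤ N by the first
  -- entry, and m ≤ R by the second because N ≤ 2ρ. Then ε/m = κ a/N and ε ≤ θ a/N.
  set c₀ := min (1 / 2) (R / (2 * ρ)) with hc₀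
  have hc₀0 : 0 < c₀ := lt_min (by norm_num) (by positivity)
  set θ := 2 * ρ * Real.sqrt d with hθ
  set κ := Real.sqrt d / c₀ with hκ
  set C₂ := κ * d * (1 + κ) ^ (d - 1) + (1 + κ) ^ d with hC₂
  refine ⟨L * θ * W + M * (C₁ * (θ + θ ^ d)) + 2 * M * (C₂ * W), by positivity,
    fun A hA hAnt hρ a ha u => ?_⟩
  have hne := hAnt.nonempty
  have hd := hAnt.one_le_of_euc
  set N := A.infsep with hN
  have hN0 : 0 < N := hA.infsep_pos_iff_nontrivial.2 hAnt
  have hNρ : N ≤ 2 * ρ := hAnt.infsep_le_two_mul hρ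
  set t := a / N with ht
  have ht0 : 0 < t := by positivity
  have hd0 : 0 < Real.sqrt d := Real.sqrt_pos.2 (by exact_mod_cast hd)
  have hm0 : 0 < c₀ * N := by positivity
  have hmR : c₀ * N ≤ R := by
    calc c₀ * N ≤ R / (2 * ρ) * (2 * ρ) := by gcongr; exact min_le_right _ _
      _ = R := by field_simp
  have hmA : 2 * (c₀ * N) ≤ N := by
    have : c₀ * N ≤ 1 / 2 * N := by gcongr; exact min_le_left _ _
    linarith
  have key := norm_voronoiEstimator_sub_voronoiTensor_le hd hb hL hM hA hne hρ hm0 hmR hmA ha u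
  have hεt : a * Real.sqrt d ≤ θ * t := by
    calc a * Real.sqrt d = N * Real.sqrt d * t := by rw [ht]; field_simp
      _ ≤ 2 * ρ * Real.sqrt d * t := by gcongr
  have hVW : volume.real (Metric.cthickening R A) ≤ W := by
    refine measureReal_mono (fun x hx => mem_closedBall_zero_iff.2 ?_)
      measure_closedBall_lt_top.ne
    have := norm_le_infDist_add hA.isClosed hne hρ x
    linarith [(mem_cthickening_iff_infDist_le hR.le hne).1 hx]
  have hκt : a * Real.sqrt d / (c₀ * N) = κ * t := by rw [hκ, ht]; field_simp
  set m := max t (t ^ d) with hm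
  have hm1 : t ≤ m := le_max_left _ _
  have k1 : L * (a * Real.sqrt d) * volume.real (Metric.cthickening R A) ≤ L * θ * W * m := by
    have h1 : a * Real.sqrt d ≤ θ * m := hεt.trans (by gcongr)
    calc _ ≤ L * (θ * m) * W :=
          mul_le_mul (mul_le_mul_of_nonneg_left h1 hL) hVW measureReal_nonneg (by positivity)
      _ = _ := by ring
  have k2 : M * volume.real {x | R - a * Real.sqrt d ≤ Metric.infDist x A ∧
      Metric.infDist x A ≤ R + a * Real.sqrt d} ≤ M * (C₁ * (θ + θ ^ d)) * m := by
    have h1 := hshell A hA.isClosed hne hρ (a * Real.sqrt d) (by positivity)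
    have h2 : max (a * Real.sqrt d) ((a * Real.sqrt d) ^ d) ≤ max (θ * t) ((θ * t) ^ d) :=
      max_le_max hεt (by gcongr)
    calc _ ≤ M * (C₁ * ((θ + θ ^ d) * m)) := by
          gcongr
          exact h1.trans (by gcongr; exact h2.trans (max_mul_pow_le (by positivity) ht0.le d))
      _ = _ := by ring
  have k3 : 2 * M * (((1 + a * Real.sqrt d / (c₀ * N)) ^ d - 1) *
      volume.real (Metric.cthickening R A)) ≤ 2 * M * (C₂ * W) * m := by
    rw [hκt]
    have h1 := one_add_mul_pow_sub_one_le (by positivity : 0 ≤ κ) ht0.le d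
    have h0 : 0 ≤ (1 + κ * t) ^ d - 1 := by
      rw [sub_nonneg]
      exact one_le_pow₀ (by linarith [(by positivity : 0 ≤ κ * t)])
    calc _ ≤ 2 * M * ((C₂ * m) * W) := by gcongr
      _ = _ := by ring
  linarith

/-- The error bound for the estimator, uniformly in the shift of the grid. -/
theorem exists_norm_voronoiEstimator_sub_le (d r s : ℕ) {R ρ : ℝ} (hR : 0 < R) (hρ0 : 0 < ρ) :
    ∃ C : ℝ, 0 < C ∧
      ∀ K : Set (Euc d), IsCompact K → K.Nonempty → K ⊆ Metric.closedBall 0 ρ →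
      ∀ K₀ : Set (Euc d), K₀.Finite → K₀.Nontrivial → K₀ ⊆ Metric.closedBall 0 ρ →
      ∀ a : ℝ, 0 < a → ∀ u : Euc d,
        ‖voronoiEstimator r s R K₀ a u - voronoiTensor r s R K‖ ≤
          C * (Real.sqrt (Metric.hausdorffDist K K₀) +
            max (a / K₀.infsep) ((a / K₀.infsep) ^ d)) ∧
        (r = 0 → s = 0 →
          ‖voronoiEstimator r s R K₀ a u - voronoiTensor r s R K‖ ≤
            C * (Metric.hausdorffDist K K₀ +
              max (a / K₀.infsep) ((a / K₀.infsep) ^ d))) := by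
  rcases Nat.eq_zero_or_pos d with rfl | hd
  -- In dimension 0 no set has two points.
  · exact ⟨1, one_pos, fun K _ _ _ K₀ _ hnt => absurd hnt.one_le_of_euc (by norm_num)⟩
  obtain ⟨C₁, hC₁, h1⟩ := exists_norm_voronoiEstimator_sub_voronoiTensor_le d r s hR hρ0
  obtain ⟨C₂, hC₂, h2⟩ := exists_norm_voronoiTensor_sub_le hd r s hR hρ0.le
  refine ⟨C₁ + C₂ + 1, by positivity, fun K hK hKn hKρ K₀ hf hnt hρ a ha u => ?_⟩
  have k1 := h1 K₀ hf hnt hρ a ha u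
  obtain ⟨k2, k3⟩ := h2 K K₀ hK.isClosed hKn hKρ hf.isClosed hnt.nonempty hρ
  rw [norm_sub_rev] at k2 k3
  have htri := norm_sub_le_norm_sub_add_norm_sub (voronoiEstimator r s R K₀ a u)
    (voronoiTensor r s R K₀) (voronoiTensor r s R K)
  set m := max (a / K₀.infsep) ((a / K₀.infsep) ^ d)
  have hm : 0 ≤ m := (div_nonneg ha.le Set.infsep_nonneg).trans (le_max_left _ _)
  have comb : ∀ δ : ℝ, 0 ≤ δ → C₁ * m + C₂ * δ ≤ (C₁ + C₂ + 1) * (δ + m) := by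
    intro δ hδ
    have : 0 ≤ C₁ * δ + C₂ * m + δ + m := by positivity
    linarith
  exact ⟨by linarith [comb _ (Real.sqrt_nonneg (Metric.hausdorffDist K K₀))],
    fun hr hs => by linarith [k3 hr hs, comb _ (Metric.hausdorffDist_nonneg (s := K) (t := K₀))]⟩

theorem tendsto_voronoiEstimator {d r s : ℕ} {R : ℝ} (hR : 0 < R) {K : Set (Euc d)}
    (hK : IsCompact K) (hKn : K.Nonempty) {K₀ : ℕ → Set (Euc d)} (hf : ∀ i, (K₀ i).Finite)
    (hnt : ∀ i, (K₀ i).Nontrivial) {a : ℕ → ℝ} (ha : ∀ i, 0 < a i)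
    (hH : Tendsto (fun i => Metric.hausdorffDist (K₀ i) K) atTop (𝓝 0))
    (hN : Tendsto (fun i => ((K₀ i).infsep)⁻¹ * a i) atTop (𝓝 0)) (u : ℕ → Euc d) :
    Tendsto (fun i => voronoiEstimator r s R (K₀ i) (a i) (u i)) atTop
      (𝓝 (voronoiTensor r s R K)) := by
  have hd : 1 ≤ d := (hnt 0).one_le_of_euc
  obtain ⟨ρ, hρ0, hKρ⟩ := hK.isBounded.subset_closedBall_lt 0 (0 : Euc d)
  obtain ⟨C, -, hC⟩ := exists_norm_voronoiEstimator_sub_le d r s hR (by linarith : 0 < ρ + 1)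
  rw [tendsto_iff_norm_sub_tendsto_zero]
  have hlim : Tendsto (fun i => C * (Real.sqrt (Metric.hausdorffDist K (K₀ i)) +
      max (a i / (K₀ i).infsep) ((a i / (K₀ i).infsep) ^ d))) atTop (𝓝 0) := by
    have h1 : Tendsto (fun i => Real.sqrt (Metric.hausdorffDist K (K₀ i))) atTop (𝓝 0) := by
      simp only [Metric.hausdorffDist_comm (s := K)]
      simpa using hH.sqrt
    have h2 : Tendsto (fun i => a i / (K₀ i).infsep) atTop (𝓝 0) := by
      simpa only [div_eq_inv_mul] using hN
    have h3 := h2.pow d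
    rw [zero_pow (by omega)] at h3
    simpa using (h1.add (h2.max h3)).const_mul C
  refine squeeze_zero' (Eventually.of_forall fun i => norm_nonneg _) ?_ hlim
  -- Once the Hausdorff distance is below 1, the approximating set lies in the ball of radius ρ + 1,
  -- so one constant serves for all large i.
  filter_upwards [hH.eventually_lt_const one_pos] with i hi
  refine (hC K hK hKn (hKρ.trans (Metric.closedBall_subset_closedBall (by linarith))) (K₀ i)
    (hf i) (hnt i) (fun x hx => mem_closedBall_zero_iff.2 ?_) (a i) (ha i) (u i)).1
  have hfin := Metric.hausdorffEDist_ne_top_of_nonempty_of_bounded (hnt i).nonempty hKn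
    (hf i).isBounded hK.isBounded
  have h1 := Metric.infDist_le_hausdorffDist_of_mem hx hfin
  linarith [norm_le_infDist_add hK.isClosed hKn hKρ x]

theorem theorem4p3 (d r s : ℕ) (R : ℝ) (hR : 0 < R) :
    (∀ ρ : ℝ, 0 < ρ → ∃ C : ℝ, 0 < C ∧
      ∀ K : Set (Euc d), IsCompact K → K.Nonempty → K ⊆ Metric.closedBall 0 ρ →
      ∀ K₀ : Set (Euc d), K₀.Finite → K₀.Nontrivial → K₀ ⊆ Metric.closedBall 0 ρ →
      ∀ a : ℝ, 0 < a →
      ∀ (Ω : Type*) [MeasurableSpace Ω] (P : Measure Ω) [IsProbabilityMeasure P]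
        (U : Ω → Euc d), IsUniformOnCube P a U →
        (∀ᵐ ω ∂P, ‖voronoiEstimator r s R K₀ a (U ω) - voronoiTensor r s R K‖ ≤
          C * (Real.sqrt (Metric.hausdorffDist K K₀) +
            max (a / K₀.infsep) ((a / K₀.infsep) ^ d))) ∧
        (r = 0 → s = 0 →
          ∀ᵐ ω ∂P, ‖voronoiEstimator r s R K₀ a (U ω) - voronoiTensor r s R K‖ ≤
            C * (Metric.hausdorffDist K K₀ +
              max (a / K₀.infsep) ((a / K₀.infsep) ^ d)))) ∧
    (∀ K : Set (Euc d), IsCompact K → K.Nonempty →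
      ∀ K₀ : ℕ → Set (Euc d), (∀ i, (K₀ i).Finite) → (∀ i, (K₀ i).Nontrivial) →
      ∀ a : ℕ → ℝ, (∀ i, 0 < a i) →
      Tendsto (fun i => Metric.hausdorffDist (K₀ i) K) atTop (𝓝 0) →
      Tendsto (fun i => ((K₀ i).infsep)⁻¹ * a i) atTop (𝓝 0) →
      ∀ (Ω : Type*) [MeasurableSpace Ω] (P : Measure Ω) [IsProbabilityMeasure P]
        (U : ℕ → Ω → Euc d), (∀ i, IsUniformOnCube P (a i) (U i)) →
        ∀ᵐ ω ∂P, Tendsto (fun i => voronoiEstimator r s R (K₀ i) (a i) (U i ω)) atTop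
          (𝓝 (voronoiTensor r s R K))) := by
  refine ⟨fun ρ hρ => ?_, fun K hK hKn K₀ hf hnt a ha hH hN Ω _ P _ U _ =>
    Eventually.of_forall fun ω => tendsto_voronoiEstimator hR hK hKn hf hnt ha hH hN _⟩
  obtain ⟨C, hC, h⟩ := exists_norm_voronoiEstimator_sub_le d r s hR hρ
  refine ⟨C, hC, fun K hK hKn hKρ K₀ hf hnt hK₀ρ a ha Ω _ P _ U _ => ⟨?_, fun hr hs => ?_⟩⟩
  · exact Eventually.of_forall fun ω => (h K hK hKn hKρ K₀ hf hnt hK₀ρ a ha (U ω)).1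
  · exact Eventually.of_forall fun ω => (h K hK hKn hKρ K₀ hf hnt hK₀ρ a ha (U ω)).2 hr hs
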